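/- An integer-matrix binary cubic form is a form $f(x,y)=ax^3+3bx^2y+3cxy^2+dy^3$ with $a,b,c,d\in\mathbb Z$. Its reduced discriminant is $\mathrm{disc}(f)=-3b^2c^2+4ac^3+4b^3d+a^2d^2-6abcd$, and $\gamma\in\mathrm{SL}_2(\mathbb Z)$ acts by $(\gamma f)(x,y)=f((x,y)\gamma)$. The form $f$ is reducible if it factors over $\mathbb Q$. A quadratic ring is a commutative ring $\mathcal O$ that is free of rank $2$ as a $\mathbb Z$-module; an orientation of it is an isomorphism $\pi:\mathcal O/\mathbb Z\to\mathbb Z$. For a quadratic ring $\mathcal O$ with $\mathrm{Disc}(\mathcal O)\neq0$ consider the triples $(\mathcal O,I,\delta)$ where $I\subset\mathcal O\otimes\mathbb Q$ is a full-rank fractional ideal of $\mathcal O$ and $\delta\in(\mathcal O\otimes\mathbb Q)^\times$ satisfies $I^3\subseteq\delta\mathcal O$ and $N(I)^3=N(\delta)$; two triples $(\mathcal O,I,\delta)$, $(\mathcal O,I',\delta')$ are equivalent if $I'=\kappa I$ and $\delta'=\kappa^3\delta$ for some $\kappa\in(\mathcal O\otimes\mathbb Q)^\times$. A triple is projective if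 $I$ is invertible. Let $H(\mathcal O)$ be the set of equivalence classes of projective triples, and $H_{\rm red}(\mathcal O)\subseteq H(\mathcal O)$ the set of classes of triples for which $\delta$ is a cube in $(\mathcal O\otimes\mathbb Q)^\times$. If $\mathcal O$ is oriented by $\pi$, $\tau\in\mathcal O$ has $\pi(\tau)=1$, and $\langle\alpha,\beta\rangle$ is a $\mathbb Z$-basis of $I$ whose change-of-basis matrix from $\langle1,\tau\rangle$ has positive determinant, then the form $f=(a,b,c,d)$ with $\alpha^3=\delta(e_0+a\tau)$, $\alpha^2\beta=\delta(e_1+b\tau)$, $\alpha\beta^2=\delta(e_2+c\tau)$, $\beta^3=\delta(e_3+d\tau)$ for some $e_0,\dots,e_3\in\mathbb Z$ is said to correspond to $(\mathcal O,I,\delta)$. A form of nonzero reduced discriminant is projective if it corresponds to a projective triple over some oriented quadratic ring of nonzero discriminant. **Proposition.** For a nonzero integer $D$ let $h_{\rm proj,red}(D)$ be the number of $\mathrm{SL}_2(\mathbb Z)$-equivalence classes of projective and reducible integer-matrix binary cubic forms of reduced discriminant $D$. This number is finite, and $|H_{\rm red}(\mathcal O)|=h_{\rm proj,red}(\mathrm{Disc}(\mathcal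 O))$ (both finite) for every quadratic ring $\mathcal O$ with $\mathrm{Disc}(\mathcal O)\ne0$. For every real $X$ there are only finitely many isomorphism classes of quadratic rings $\mathcal O$ with $0<|\mathrm{Disc}(\mathcal O)|<X$. Moreover, for every real $X$ the first equality in each line below holds, and as $X\to\infty$ $$\sum_{0<\mathrm{Disc}(\mathcal O)<X}|H_{\rm red}(\mathcal O)|=\sum_{0<D<X}h_{\rm proj,red}(D)=\frac{\zeta(2)}{2\zeta(3)}\,X+o(X),$$ $$\sum_{0<-\mathrm{Disc}(\mathcal O)<X}|H_{\rm red}(\mathcal O)|=\sum_{0<-D<X}h_{\rm proj,red}(D)=\frac{\zeta(2)}{2\zeta(3)}\,X+o(X),$$ where the sums on the left are over isomorphism classes of quadratic rings $\mathcal O$ and $\zeta$ is the Riemann zeta function. -/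

import Mathlib

open scoped TensorProduct

namespace CubicCount

/-! ### Integer-matrix binary cubic forms -/

/-- The integer-matrix binary cubic form `a x³ + 3 b x² y + 3 c x y² + d y³`. -/
@[ext] structure CubicForm where
  a : ℤ
  b : ℤ
  c : ℤ
  d : ℤ

namespace CubicForm

/-- The value `f(x, y)` in a commutative ring. -/
def eval {R : Type*} [CommRing R] (f : CubicForm) (x y : R) : R :=
  (f.a : R) * x ^ 3 + 3 * (f.b : R) * x ^ 2 * y + 3 * (f.c : R) * x * y ^ 2 + (f.d : R) * y ^ 3

/-- The reduced discriminant, that is, `-1/27` times the usual discriminant of `f`. -/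
def disc (f : CubicForm) : ℤ :=
  -3 * f.b ^ 2 * f.c ^ 2 + 4 * f.a * f.c ^ 3 + 4 * f.b ^ 3 * f.d + f.a ^ 2 * f.d ^ 2
    - 6 * f.a * f.b * f.c * f.d

/-- `f` factors over `ℚ`: it is the product of a linear form and a quadratic form. -/
def IsReducible (f : CubicForm) : Prop :=
  ∃ p q r s t : ℚ, ∀ x y : ℚ,
    f.eval x y = (p * x + q * y) * (r * x ^ 2 + s * x * y + t * y ^ 2)

/-- `g = γ f` for some `γ ∈ SL₂(ℤ)`, where `(γ f)(x, y) = f((x, y) γ)`. -/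
def Equivalent (f g : CubicForm) : Prop :=
  ∃ γ : Matrix.SpecialLinearGroup (Fin 2) ℤ, ∀ x y : ℤ,
    g.eval x y = f.eval (x * γ.1 0 0 + y * γ.1 1 0) (x * γ.1 0 1 + y * γ.1 1 1)

theorem equivalent_refl (f : CubicForm) : f.Equivalent f :=
  ⟨1, fun x y => by simp⟩

theorem equivalent_symm {f g : CubicForm} (h : f.Equivalent g) : g.Equivalent f := by
  obtain ⟨γ, h⟩ := h
  refine ⟨γ⁻¹, fun x y => ?_⟩
  have hd : γ.1 0 0 * γ.1 1 1 - γ.1 0 1 * γ.1 1 0 = 1 := by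
    rw [← Matrix.det_fin_two]; exact γ.2
  rw [h]
  simp only [Matrix.SpecialLinearGroup.coe_inv, Matrix.adjugate_fin_two, Matrix.of_apply,
    Matrix.cons_val', Matrix.cons_val_zero, Matrix.cons_val_one, Matrix.cons_val_fin_one]
  congr 1
  · linear_combination (-x) * hd
  · linear_combination (-y) * hd

theorem equivalent_trans {f g k : CubicForm} (h₁ : f.Equivalent g) (h₂ : g.Equivalent k) :
    f.Equivalent k := by
  obtain ⟨γ, h₁⟩ := h₁
  obtain ⟨η, h₂⟩ := h₂
  refine ⟨η * γ, fun x y => ?_⟩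
  rw [h₂, h₁]
  simp only [Matrix.SpecialLinearGroup.coe_mul, Matrix.mul_apply, Fin.sum_univ_two]
  congr 1 <;> ring

/-- `SL₂(ℤ)`-equivalence. -/
instance equivalence : Setoid CubicForm :=
  ⟨Equivalent, equivalent_refl, equivalent_symm, equivalent_trans⟩

end CubicForm

/-! ### Quadratic rings and triples `(O, I, δ)` -/

/-- A quadratic ring: a commutative ring that is free of rank 2 as a `ℤ`-module. -/
class IsQuadraticRing (O : Type*) [CommRing O] : Prop where
  free : Module.Free ℤ O
  finite : Module.Finite ℤ O
  finrank_eq : Module.finrank ℤ O = 2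

attribute [instance] IsQuadraticRing.free IsQuadraticRing.finite

/-- The discriminant of a quadratic ring. -/
noncomputable def ringDisc (O : Type*) [CommRing O] [IsQuadraticRing O] : ℤ :=
  Algebra.discr ℤ (Module.finBasis ℤ O)

/-- An orientation of `O`: an isomorphism `O / ℤ ≅ ℤ`. -/
abbrev Orientation (O : Type*) [CommRing O] : Type _ :=
  (O ⧸ Submodule.span ℤ {(1 : O)}) ≃ₗ[ℤ] ℤ

/-- The algebra `O ⊗ ℚ`. -/
def RatAlg (O : Type*) [CommRing O] : Type _ := O ⊗[ℤ] ℚ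

noncomputable instance (O : Type*) [CommRing O] : CommRing (RatAlg O) :=
  inferInstanceAs (CommRing (O ⊗[ℤ] ℚ))

noncomputable instance (O : Type*) [CommRing O] : Algebra O (RatAlg O) :=
  inferInstanceAs (Algebra O (O ⊗[ℤ] ℚ))

noncomputable instance (O : Type*) [CommRing O] : Algebra ℚ (RatAlg O) :=
  (Algebra.TensorProduct.includeRight : ℚ →ₐ[ℤ] O ⊗[ℤ] ℚ).toRingHom.toAlgebra

/-- The norm of a full-rank `O`-submodule `I` of `O ⊗ ℚ`: the generalized index
`[O : O ∩ I] / [I : O ∩ I]`. -/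
noncomputable def idealNorm {O : Type*} [CommRing O] (I : Submodule O (RatAlg O)) : ℚ :=
  (I.toAddSubgroup.relIndex (1 : Submodule O (RatAlg O)).toAddSubgroup : ℚ) /
    ((1 : Submodule O (RatAlg O)).toAddSubgroup.relIndex I.toAddSubgroup : ℚ)

/-- A pair `(I, δ)` such that `(O, I, δ)` is a triple as in the parametrization of cubic forms:
`I` is a (full-rank, fractional) ideal of `O`, `δ` is a unit of `O ⊗ ℚ`,
`I³ ⊆ δ O` and `N(I)³ = N(δ)`. -/
@[ext] structure Triple (O : Type*) [CommRing O] where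
  I : Submodule O (RatAlg O)
  δ : (RatAlg O)ˣ
  fg : I.FG
  full : Submodule.span ℚ (I : Set (RatAlg O)) = ⊤
  cube_le : I ^ 3 ≤ Submodule.span O {(δ : RatAlg O)}
  norm_eq : idealNorm I ^ 3 = Algebra.norm ℚ (δ : RatAlg O)

namespace Triple

variable {O : Type*} [CommRing O]

/-- `(O, I, δ)` and `(O, I', δ')` are equivalent if `I' = κ I` and `δ' = κ³ δ` for some `κ`. -/
def Equivalent (T T' : Triple O) : Prop :=
  ∃ κ : (RatAlg O)ˣ, T'.I = Submodule.span O {(κ : RatAlg O)} * T.I ∧ T'.δ = κ ^ 3 * T.δ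

theorem equivalent_refl (T : Triple O) : T.Equivalent T :=
  ⟨1, by rw [Units.val_one, ← Submodule.one_eq_span, one_mul], by simp⟩

theorem equivalent_symm {T T' : Triple O} (h : T.Equivalent T') : T'.Equivalent T := by
  obtain ⟨κ, h₁, h₂⟩ := h
  refine ⟨κ⁻¹, ?_, ?_⟩
  · rw [h₁, ← mul_assoc, Submodule.span_mul_span, Set.singleton_mul_singleton, Units.inv_mul,
      ← Submodule.one_eq_span, one_mul]
  · rw [h₂, inv_pow, inv_mul_cancel_left]

theorem equivalent_trans {T T' T'' : Triple O} (h : T.Equivalent T') (h' : T'.Equivalent T'') :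
    T.Equivalent T'' := by
  obtain ⟨κ, h₁, h₂⟩ := h
  obtain ⟨μ, h₃, h₄⟩ := h'
  refine ⟨μ * κ, ?_, ?_⟩
  · rw [h₃, h₁, ← mul_assoc, Submodule.span_mul_span, Set.singleton_mul_singleton, Units.val_mul]
  · rw [h₄, h₂, mul_pow, mul_assoc]

instance equivalence : Setoid (Triple O) :=
  ⟨Equivalent, equivalent_refl, equivalent_symm, equivalent_trans⟩

/-- A triple is projective if `I` is an invertible ideal. -/
def IsProjective (T : Triple O) : Prop := IsUnit T.I

/-- The form `f = (a, b, c, d)` is attached to `(O, I, δ)`, where `O` is oriented by `π`: for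
`τ ∈ O` with `π(τ) = 1` and some positively oriented `ℤ`-basis `⟨α, β⟩` of `I`, the `τ`-coordinates
of `α³/δ`, `α²β/δ`, `αβ²/δ`, `β³/δ` with respect to `⟨1, τ⟩` are `a`, `b`, `c`, `d`. -/
def Corresponds (π : Orientation O) (T : Triple O) (f : CubicForm) : Prop :=
  ∃ τ : O, π (Submodule.Quotient.mk τ) = 1 ∧
  ∃ α β : RatAlg O, T.I.toAddSubgroup = AddSubgroup.closure {α, β} ∧
    (∃ p q r s : ℚ, α = algebraMap ℚ _ p + algebraMap ℚ _ q * algebraMap O _ τ ∧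
      β = algebraMap ℚ _ r + algebraMap ℚ _ s * algebraMap O _ τ ∧ 0 < p * s - q * r) ∧
    ∃ e₀ e₁ e₂ e₃ : ℤ,
      α ^ 3 = T.δ * algebraMap O _ (e₀ + f.a * τ) ∧
      α ^ 2 * β = T.δ * algebraMap O _ (e₁ + f.b * τ) ∧
      α * β ^ 2 = T.δ * algebraMap O _ (e₂ + f.c * τ) ∧
      β ^ 3 = T.δ * algebraMap O _ (e₃ + f.d * τ)

end Triple

/-- The set `H(O)` of equivalence classes of projective triples `(O, I, δ)`. -/
def H (O : Type*) [CommRing O] : Set (Quotient (Triple.equivalence (O := O))) :=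
  {q | ∃ T : Triple O, ⟦T⟧ = q ∧ T.IsProjective}

/-- The set `H_red(O)` of the classes in `H(O)` of triples for which `δ` is a cube. -/
def HRed (O : Type*) [CommRing O] : Set (Quotient (Triple.equivalence (O := O))) :=
  {q | q ∈ H O ∧ ∃ T : Triple O, ⟦T⟧ = q ∧ ∃ ξ : (RatAlg O)ˣ, T.δ = ξ ^ 3}

/-- A quadratic ring, bundled. -/
structure QuadRing where
  carrier : Type
  [commRing : CommRing carrier]
  [isQuadraticRing : IsQuadraticRing carrier]

attribute [instance] QuadRing.commRing QuadRing.isQuadraticRing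

/-- Isomorphism of quadratic rings. -/
instance QuadRing.iso : Setoid QuadRing :=
  ⟨fun R S => Nonempty (R.carrier ≃+* S.carrier), fun _ => ⟨RingEquiv.refl _⟩,
    fun ⟨e⟩ => ⟨e.symm⟩, fun ⟨e⟩ ⟨e'⟩ => ⟨e.trans e'⟩⟩

/-- The isomorphism classes of quadratic rings. -/
def QuadRingClass : Type 1 := Quotient QuadRing.iso

/-- A quadratic ring representing an isomorphism class. -/
noncomputable def QuadRingClass.rep (q : QuadRingClass) : QuadRing := Quotient.out q

/-- The discriminant of the quadratic rings in an isomorphism class. -/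
noncomputable def QuadRingClass.disc (q : QuadRingClass) : ℤ := ringDisc q.rep.carrier

/-- The number `|H_red(O)|` for the quadratic rings `O` in an isomorphism class. -/
noncomputable def QuadRingClass.hRed (q : QuadRingClass) : ℕ := (HRed q.rep.carrier).ncard

/-! ### The counting functions -/

/-- A (nondegenerate) form is projective if the triple `(O, I, δ)` that corresponds to it, with
`O` a nondegenerate oriented quadratic ring, is projective. -/
def CubicForm.IsProjective (f : CubicForm) : Prop :=
  ∃ (R : QuadRing) (π : Orientation R.carrier) (T : Triple R.carrier),
    ringDisc R.carrier ≠ 0 ∧ T.Corresponds π f ∧ T.IsProjective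

/-- The `SL₂(ℤ)`-classes of projective reducible forms of reduced discriminant `D`. -/
def projRedClasses (D : ℤ) : Set (Quotient CubicForm.equivalence) :=
  {q | ∃ f : CubicForm, ⟦f⟧ = q ∧ f.IsProjective ∧ f.IsReducible ∧ f.disc = D}

/-- The number `h_{proj,red}(D)`. -/
noncomputable def hProjRed (D : ℤ) : ℕ := (projRedClasses D).ncard

/-- The sum of `h_{proj,red}(D)` over the integers `D` in `s`. -/
noncomputable def sumH (s : Set ℤ) : ℕ := ∑ᶠ D ∈ s, hProjRed D

/-- The sum of `|H_red(O)|` over the isomorphism classes of quadratic rings with `Disc(O) ∈ s`. -/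
noncomputable def sumHRed (s : Set ℤ) : ℕ :=
  ∑ᶠ (q : QuadRingClass) (_ : q.disc ∈ s), q.hRed

/-- The integers `D` with `0 < D < X`. -/
def posRange (X : ℝ) : Set ℤ := {D | 0 < D ∧ (D : ℝ) < X}

/-- The integers `D` with `0 < -D < X`. -/
def negRange (X : ℝ) : Set ℤ := {D | 0 < -D ∧ (-D : ℝ) < X}

end CubicCount

/-!
A projective reducible class is counted by its reduced forms, the forms
`f = 3 b x² y + 3 c x y² + d y³` with `b > 0` and `0 ≤ c < 2 b`: a rational root can be moved to
`(1, 0)` by `SL₂(ℤ)`, and the stabilizer of that root changes the sign of `(b, c, d)` and shifts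
`c` by multiples of `2 b`. The discriminant of `f` is `b² (4 b d - 3 c²)`.

*Triples.* A triple that corresponds to such an `f` has a normal form
(`Triple.Corresponds.normalForm`): after scaling, `δ = 1` and `I = ℤ b + ℤ θ / b`, where
`O = ℤ[θ]` and `θ² = b c θ - b² (c² - b d)`. Hence `Disc(O) = disc(f)`, the form determines the
class of the triple, and the triple is projective exactly when `b` and `c` are coprime: if `p`
divides both, then `θ / p` multiplies `I` into itself, and in the coprime case the conjugate ideal
is an inverse of `I`. Conversely, a triple for which `δ` is a cube can be scaled to `δ = 1`; a
`ℤ`-basis of `I` that starts with a rational number then gives a form with `a = 0`. So `H_red(O)`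
and the set of projective reducible classes of discriminant `Disc(O)` are quotients of the same
finite set of reduced forms (`redForms`) by the same relation (`exists_range_eq_hRed`). As a
quadratic ring is determined up to isomorphism by its discriminant, the two sums agree term by
term.

*Counting.* A class contains only one reduced form unless `f` has a second rational root, in which
case `-3 disc(f)` is a square (`CubicForm.IsReduced.eq_of_equivalent`). For fixed `b` there are
`2 φ(b)` residues `c` modulo `2 b` prime to `b`, and each leaves `X / (4 b³) + O(1)` values of
`d`, so that there are `φ(b) X / (2 b³) + O_b(1)` reduced forms with `0 < |disc| < X` and disc of
given sign, of which only `O_b(√X)` have a second rational root. For the sum over `b` one needs a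
bound that is linear in `X` and uniform in `b`. Grouping by the value `n` of `|disc| / b²`, one
has at most `X / b²` values `n`, and for each of them the congruence `3 c² ≡ ± n` modulo `b` has
at most `36 τ(b) ≤ 72 √b` solutions `c` prime to `b` (`card_residues_dvd_le`). The bound
`72 b^(-3/2) X` is summable, so dominated convergence gives the main term `(X / 2) ∑ φ(b) / b³`,
which is `ζ(2) X / (2 ζ(3))`.
-/

open scoped TensorProduct

namespace CubicCount

/-! ### Quadratic rings -/

/-- `1, τ` is a `ℤ`-basis of `O`. -/
structure IsGen {O : Type*} [CommRing O] (τ : O) : Prop where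
  exists_eq : ∀ x : O, ∃ m k : ℤ, x = m + k * τ
  eq_zero : ∀ m k : ℤ, (m : O) + k * τ = 0 → m = 0 ∧ k = 0

section
variable {O : Type*} [CommRing O]

theorem isGen_of_orientation [IsQuadraticRing O] (π : Orientation O) {τ : O}
    (hτ : π (Submodule.Quotient.mk τ) = 1) : IsGen τ := by
  have h1 : ∀ m k : ℤ, π (Submodule.Quotient.mk ((m : O) + k * τ)) = k := by
    intro m k
    have h : (Submodule.Quotient.mk ((m : O) + k * τ) : O ⧸ Submodule.span ℤ {(1 : O)}) =
        k • Submodule.Quotient.mk τ := by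
      rw [← Submodule.Quotient.mk_smul, Submodule.Quotient.eq]
      refine Submodule.mem_span_singleton.2 ⟨m, ?_⟩
      simp [zsmul_eq_mul]
    rw [h, map_zsmul, hτ]; simp
  have hnt : Nontrivial O := by
    apply Module.nontrivial_of_finrank_pos (R := ℤ)
    rw [IsQuadraticRing.finrank_eq]; norm_num
  refine ⟨fun x => ?_, fun m k h => ?_⟩
  · have : (Submodule.Quotient.mk x : O ⧸ Submodule.span ℤ {(1 : O)}) =
        Submodule.Quotient.mk ((π (Submodule.Quotient.mk x) : ℤ) • τ) := by
      apply π.injective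
      rw [Submodule.Quotient.mk_smul, map_zsmul, hτ]; simp
    rw [Submodule.Quotient.eq, Submodule.mem_span_singleton] at this
    obtain ⟨m, hm⟩ := this
    refine ⟨m, π (Submodule.Quotient.mk x), ?_⟩
    simp only [zsmul_eq_mul, mul_one] at hm
    linear_combination -hm
  · have hk : k = 0 := by rw [← h1 m k, h]; simp
    subst hk
    refine ⟨?_, rfl⟩
    have : m • (1 : O) = 0 := by simpa using h
    exact (smul_eq_zero.1 this).resolve_right one_ne_zero

theorem IsGen.inj {τ : O} (h : IsGen τ) {m k m' k' : ℤ} (e : (m : O) + k * τ = m' + k' * τ) :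
    m = m' ∧ k = k' := by
  have := h.eq_zero (m - m') (k - k') (by push_cast; linear_combination e)
  omega

theorem IsGen.exists_sq {τ : O} (h : IsGen τ) : ∃ t n : ℤ, τ ^ 2 = t * τ - n := by
  obtain ⟨m, k, e⟩ := h.exists_eq (τ ^ 2)
  exact ⟨k, -m, by rw [e]; push_cast; ring⟩

theorem IsGen.add_int {τ : O} (h : IsGen τ) (r : ℤ) : IsGen ((r : O) + τ) := by
  refine ⟨fun x => ?_, fun m k e => ?_⟩
  · obtain ⟨m, k, rfl⟩ := h.exists_eq x
    exact ⟨m - k * r, k, by push_cast; ring⟩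
  · have := h.eq_zero (m + k * r) k (by rw [← e]; push_cast; ring)
    obtain ⟨h1, rfl⟩ := this
    simpa using h1

/-- The `ℤ`-basis `1, τ` of `O`. -/
noncomputable def IsGen.basis {τ : O} (h : IsGen τ) : Module.Basis (Fin 2) ℤ O :=
  Module.Basis.mk (v := ![1, τ])
    (by
      rw [LinearIndependent.pair_iff]
      intro s t e
      exact h.eq_zero s t (by simpa using e))
    (by
      intro x _
      obtain ⟨m, k, rfl⟩ := h.exists_eq x
      have h1 : (1 : O) ∈ Submodule.span ℤ (Set.range ![1, τ]) :=
        Submodule.subset_span ⟨0, rfl⟩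
      have h2 : τ ∈ Submodule.span ℤ (Set.range ![1, τ]) := Submodule.subset_span ⟨1, rfl⟩
      have := Submodule.add_mem _ (Submodule.smul_mem _ m h1) (Submodule.smul_mem _ k h2)
      simpa using this)

@[simp] theorem IsGen.basis_zero {τ : O} (h : IsGen τ) : h.basis 0 = 1 := by simp [IsGen.basis]
@[simp] theorem IsGen.basis_one {τ : O} (h : IsGen τ) : h.basis 1 = τ := by simp [IsGen.basis]

theorem IsGen.isQuadraticRing {τ : O} (h : IsGen τ) : IsQuadraticRing O where
  free := Module.Free.of_basis h.basis
  finite := Module.Finite.of_basis h.basis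
  finrank_eq := by rw [Module.finrank_eq_card_basis h.basis]; simp

theorem IsGen.repr_eq {τ : O} (h : IsGen τ) (m k : ℤ) : h.basis.repr (m + k * τ) =
    Finsupp.single 0 m + Finsupp.single 1 k := by
  have : (m : O) + k * τ = m • h.basis 0 + k • h.basis 1 := by simp
  rw [this, map_add, map_zsmul, map_zsmul, Module.Basis.repr_self, Module.Basis.repr_self]
  simp

theorem IsGen.leftMulMatrix {τ : O} (h : IsGen τ) {t n : ℤ} (e : τ ^ 2 = t * τ - n) (m k : ℤ) :
    Algebra.leftMulMatrix h.basis ((m : O) + k * τ) = !![m, -n * k; k, m + t * k] := by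
  have h0 : ((m : O) + k * τ) * h.basis 0 = (m : ℤ) + (k : ℤ) * τ := by simp
  have h1 : ((m : O) + k * τ) * h.basis 1 = ((-n * k : ℤ) : O) + ((m + t * k : ℤ) : O) * τ := by
    rw [h.basis_one]; push_cast; linear_combination (k : O) * e
  ext i j
  rw [Algebra.leftMulMatrix_eq_repr_mul]
  fin_cases j
  · simp only [Fin.zero_eta]
    rw [h0, h.repr_eq]
    fin_cases i <;> simp
  · simp only [Fin.mk_one]
    rw [h1, h.repr_eq]
    fin_cases i <;> simp

theorem IsGen.ringDisc_eq [IsQuadraticRing O] {τ : O} (h : IsGen τ) {t n : ℤ}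
    (e : τ ^ 2 = t * τ - n) : ringDisc O = t ^ 2 - 4 * n := by
  have hc : ringDisc O = Algebra.discr ℤ h.basis := by
    have e' : Fin (Module.finrank ℤ O) ≃ Fin 2 := finCongr IsQuadraticRing.finrank_eq
    rw [ringDisc, ← Algebra.discr_reindex ℤ (Module.finBasis ℤ O) e',
      ← Module.Basis.coe_reindex, Algebra.discr_eq_discr O _ h.basis]
  have ht : ∀ m k : ℤ, Algebra.trace ℤ O ((m : O) + k * τ) = 2 * m + t * k := by
    intro m k
    rw [Algebra.trace_eq_matrix_trace h.basis, h.leftMulMatrix e, Matrix.trace_fin_two]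
    simp; ring
  have h00 : Algebra.trace ℤ O (1 * 1) = 2 := by simpa using ht 1 0
  have h01 : Algebra.trace ℤ O (1 * τ) = t := by simpa using ht 0 1
  have h10 : Algebra.trace ℤ O (τ * 1) = t := by simpa using ht 0 1
  have h11 : Algebra.trace ℤ O (τ * τ) = t ^ 2 - 2 * n := by
    have := ht (-n) t
    rw [show τ * τ = ((-n : ℤ) : O) + (t : ℤ) * τ by push_cast; linear_combination e, this]; ring
  rw [hc, Algebra.discr_def, Matrix.det_fin_two]
  simp only [Algebra.traceMatrix_apply, Algebra.traceForm_apply, h.basis_zero, h.basis_one, h00, h01, h10, h11]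
  ring

/-- Every quadratic ring has a `ℤ`-basis that starts with `1`: a relation `1 = k • u` gives
`1 = k² N(u)`, so the vector `1` is primitive. -/
theorem exists_isGen (O : Type*) [CommRing O] [IsQuadraticRing O] : ∃ τ : O, IsGen τ := by
  let b : Module.Basis (Fin 2) ℤ O := (Module.finBasis ℤ O).reindex (finCongr IsQuadraticRing.finrank_eq)
  set x := b.repr 1 0
  set y := b.repr 1 1
  have h1 : (1 : O) = x • b 0 + y • b 1 := by
    conv_lhs => rw [← b.sum_repr 1]
    rw [Fin.sum_univ_two]
  have hg : Int.gcd x y = 1 := by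
    obtain ⟨x', hx⟩ := Int.gcd_dvd_left x y
    obtain ⟨y', hy⟩ := Int.gcd_dvd_right x y
    have : (1 : O) = algebraMap ℤ O (Int.gcd x y) * (x' • b 0 + y' • b 1) := by
      rw [h1]
      generalize Int.gcd x y = g at hx hy ⊢
      rw [hx, hy]
      simp only [zsmul_eq_mul, algebraMap_int_eq]
      push_cast; simp; ring
    have hn := congrArg (Algebra.norm ℤ) this
    rw [map_one, map_mul, Algebra.norm_algebraMap, IsQuadraticRing.finrank_eq] at hn
    have := Int.isUnit_iff.1 (isUnit_of_dvd_one (Dvd.intro _ hn.symm))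
    have h2 : ((Int.gcd x y : ℤ)) ^ 2 = 1 := by
      rcases this with h | h
      · exact h
      · nlinarith [sq_nonneg ((Int.gcd x y : ℤ))]
    have h3 : (Int.gcd x y) ^ 2 = 1 := by exact_mod_cast h2
    exact (Nat.pow_eq_one.1 h3).resolve_right (by norm_num)
  have hbez := Int.gcd_eq_gcd_ab x y
  rw [hg] at hbez
  set u := Int.gcdA x y
  set v := Int.gcdB x y
  push_cast at hbez
  refine ⟨-v • b 0 + u • b 1, fun z => ?_, fun m k e => ?_⟩
  · have hz : z = b.repr z 0 • b 0 + b.repr z 1 • b 1 := by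
      conv_lhs => rw [← b.sum_repr z]
      rw [Fin.sum_univ_two]
    set r := b.repr z 0
    set s := b.repr z 1
    refine ⟨r * u + s * v, -y * r + x * s, ?_⟩
    have hbez' : (1 : O) = x * u + y * v := by exact_mod_cast congrArg (Int.cast : ℤ → O) hbez
    rw [← mul_one ((r * u + s * v : ℤ) : O), h1, hz]
    simp only [zsmul_eq_mul]
    push_cast
    linear_combination (r * b 0 + s * b 1) * hbez'
  · rw [← mul_one (m : O), h1] at e
    have e' : (m * x - k * v) • b 0 + (m * y + k * u) • b 1 = 0 := by
      rw [← e]; simp only [zsmul_eq_mul]; push_cast; ring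
    have hl := LinearIndependent.pair_iff.1
      (show LinearIndependent ℤ ![b 0, b 1] by
        have hb : ![b 0, b 1] = b := by ext i; fin_cases i <;> rfl
        rw [hb]; exact b.linearIndependent)
      _ _ e'
    obtain ⟨e1, e2⟩ := hl
    constructor
    · linear_combination m * hbez + u * e1 + v * e2
    · linear_combination k * hbez + x * e2 - y * e1

/-- A generator `τ` orients `O`. -/
theorem IsGen.exists_orientation {τ : O} (h : IsGen τ) :
    ∃ π : Orientation O, π (Submodule.Quotient.mk τ) = 1 := by
  have hs : Submodule.span ℤ {(1 : O)} = LinearMap.ker (h.basis.coord 1) := by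
    ext x
    obtain ⟨m, k, rfl⟩ := h.exists_eq x
    rw [Submodule.mem_span_singleton, LinearMap.mem_ker, Module.Basis.coord_apply, h.repr_eq]
    constructor
    · rintro ⟨r, hr⟩
      have := h.inj (m := r) (k := 0) (m' := m) (k' := k) (by simpa using hr)
      simp [← this.2]
    · intro hk
      have hk : k = 0 := by simpa using hk
      exact ⟨m, by simp [hk]⟩
  refine ⟨(Submodule.quotEquivOfEq _ _ hs).trans
    ((h.basis.coord 1).quotKerEquivOfSurjective fun k => ⟨k • τ, ?_⟩), ?_⟩
  · have := h.repr_eq 0 k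
    simp at this
    simp [this]
  · have := h.repr_eq 0 1
    simp at this
    rw [LinearEquiv.trans_apply, Submodule.quotEquivOfEq_mk]
    erw [LinearMap.quotKerEquivOfSurjective_apply_mk]
    simp [this]

theorem IsGen.orientation_eq {τ θ : O} (π : Orientation O)
    (hτ : π (Submodule.Quotient.mk τ) = 1) (hθ : π (Submodule.Quotient.mk θ) = 1) :
    ∃ r : ℤ, θ = r + τ := by
  have : (Submodule.Quotient.mk θ : O ⧸ Submodule.span ℤ {(1 : O)}) = Submodule.Quotient.mk τ :=
    π.injective (by rw [hτ, hθ])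
  rw [Submodule.Quotient.eq, Submodule.mem_span_singleton] at this
  obtain ⟨r, hr⟩ := this
  exact ⟨r, by simp at hr; linear_combination -hr⟩

theorem orientation_add_int {τ : O} (π : Orientation O)
    (hτ : π (Submodule.Quotient.mk τ) = 1) (r : ℤ) : π (Submodule.Quotient.mk (r + τ)) = 1 := by
  rw [← hτ]; congr 1
  rw [Submodule.Quotient.eq, Submodule.mem_span_singleton]
  exact ⟨r, by simp⟩

/-- Quadratic rings with the same discriminant are isomorphic: after a shift of the generator the
trace is the parity of the discriminant. -/
theorem ringEquiv_of_ringDisc_eq {O O' : Type*} [CommRing O] [CommRing O'] [IsQuadraticRing O]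
    [IsQuadraticRing O'] (h : ringDisc O = ringDisc O') : Nonempty (O ≃+* O') := by
  obtain ⟨τ, hτ⟩ := exists_isGen O
  obtain ⟨σ, hσ⟩ := exists_isGen O'
  obtain ⟨t, n, e⟩ := hτ.exists_sq
  obtain ⟨t', n', e'⟩ := hσ.exists_sq
  rw [hτ.ringDisc_eq e, hσ.ringDisc_eq e'] at h
  have hpar : ∃ r, t' = t + 2 * r := by
    have : (t' - t) % 2 = 0 := by
      have h2 : (t' ^ 2 - t ^ 2) % 2 = 0 := by omega
      have : t' ^ 2 - t ^ 2 = (t' - t) * (t' - t + 2 * t) := by ring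
      rw [this] at h2
      rcases Int.emod_two_eq_zero_or_one (t' - t) with h3 | h3
      · exact h3
      · rw [Int.mul_emod, Int.add_mul_emod_self_left, h3] at h2; simp at h2
    exact ⟨(t' - t) / 2, by omega⟩
  obtain ⟨r, rfl⟩ := hpar
  have hn : n' = n + t * r + r ^ 2 := by nlinarith
  subst hn
  have hτ' := hτ.add_int r
  let f : O ≃ₗ[ℤ] O' := hτ'.basis.equiv hσ.basis (Equiv.refl _)
  have f0 : f 1 = 1 := by
    have := hτ'.basis.equiv_apply 0 hσ.basis (Equiv.refl _)
    simpa using this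
  have f1 : f (r + τ) = σ := by
    have := hτ'.basis.equiv_apply 1 hσ.basis (Equiv.refl _)
    simpa using this
  have fm : ∀ m k : ℤ, f (m + k * (r + τ)) = m + k * σ := by
    intro m k
    have : (m : O) + k * (r + τ) = m • 1 + k • (r + τ) := by
      simp only [zsmul_eq_mul, mul_one]
    rw [this, map_add, map_zsmul, map_zsmul, f0, f1]; simp
  refine ⟨{ f.toAddEquiv with map_mul' := fun x y => ?_ }⟩
  change f (x * y) = f x * f y
  obtain ⟨m, k, rfl⟩ := hτ'.exists_eq x
  obtain ⟨m', k', rfl⟩ := hτ'.exists_eq y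
  have : ((m : O) + k * (r + τ)) * (m' + k' * (r + τ)) =
      ((m * m' - k * k' * (n + t * r + r ^ 2) : ℤ) : O) +
        ((m * k' + m' * k + k * k' * (t + 2 * r) : ℤ) : O) * (r + τ) := by
    push_cast; linear_combination (k : O) * k' * e
  rw [this, fm, fm, fm]
  push_cast at e' ⊢; linear_combination (-(k : O') * k') * e'

end

/-! ### Coordinates on `O ⊗ ℚ` -/

section
variable {O : Type*} [CommRing O]

/-- The element `p + q τ` of `O ⊗ ℚ`. -/
noncomputable def coord (τ : O) (p q : ℚ) : RatAlg O :=
  algebraMap ℚ _ p + algebraMap ℚ _ q * algebraMap O _ τ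

/-- The flip `ℚ ⊗ O ≅ O ⊗ ℚ`, as a `ℚ`-linear map. -/
noncomputable def ratAlgEquiv (O : Type*) [CommRing O] : (ℚ ⊗[ℤ] O) ≃ₗ[ℚ] RatAlg O :=
  let e : (ℚ ⊗[ℤ] O) ≃+ RatAlg O := (TensorProduct.comm ℤ ℚ O).toAddEquiv
  { e with map_smul' := fun c x => map_rat_smul e c x }

/-- The `ℚ`-basis `1, τ` of `O ⊗ ℚ`. -/
noncomputable def IsGen.ratBasis {τ : O} (h : IsGen τ) : Module.Basis (Fin 2) ℚ (RatAlg O) :=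
  (Algebra.TensorProduct.basis ℚ h.basis).map (ratAlgEquiv O)

theorem IsGen.ratBasis_apply {τ : O} (h : IsGen τ) (i : Fin 2) :
    h.ratBasis i = algebraMap O (RatAlg O) (h.basis i) := by
  have : h.ratBasis i = TensorProduct.comm ℤ ℚ O (Algebra.TensorProduct.basis ℚ h.basis i) := rfl
  rw [this, Algebra.TensorProduct.basis_apply, TensorProduct.comm_tmul]
  rfl

@[simp] theorem IsGen.ratBasis_zero {τ : O} (h : IsGen τ) : h.ratBasis 0 = 1 := by
  rw [h.ratBasis_apply, h.basis_zero, map_one]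

@[simp] theorem IsGen.ratBasis_one {τ : O} (h : IsGen τ) :
    h.ratBasis 1 = algebraMap O (RatAlg O) τ := by
  rw [h.ratBasis_apply, h.basis_one]

theorem IsGen.coord_eq {τ : O} (h : IsGen τ) (p q : ℚ) :
    coord τ p q = p • h.ratBasis 0 + q • h.ratBasis 1 := by
  simp [coord, Algebra.smul_def]

theorem IsGen.ratRepr {τ : O} (h : IsGen τ) (p q : ℚ) :
    h.ratBasis.repr (coord τ p q) = Finsupp.single 0 p + Finsupp.single 1 q := by
  rw [h.coord_eq, map_add, map_smul, map_smul, Module.Basis.repr_self, Module.Basis.repr_self]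
  simp

theorem IsGen.coord_surj {τ : O} (h : IsGen τ) (x : RatAlg O) : ∃ p q, x = coord τ p q := by
  refine ⟨h.ratBasis.repr x 0, h.ratBasis.repr x 1, ?_⟩
  conv_lhs => rw [← h.ratBasis.sum_repr x, Fin.sum_univ_two]
  rw [h.coord_eq]

theorem IsGen.coord_inj {τ : O} (h : IsGen τ) {p q r s : ℚ} :
    coord τ p q = coord τ r s ↔ p = r ∧ q = s := by
  refine ⟨fun e => ?_, by rintro ⟨rfl, rfl⟩; rfl⟩
  have e' := congrArg h.ratBasis.repr e
  rw [h.ratRepr, h.ratRepr] at e'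
  have h0 := DFunLike.congr_fun e' 0
  have h1 := DFunLike.congr_fun e' 1
  simp at h0 h1
  exact ⟨h0, h1⟩

theorem algebraMap_eq_coord (τ : O) (m k : ℤ) :
    algebraMap O (RatAlg O) (m + k * τ) = coord τ m k := by
  simp [coord]

theorem algebraMap_rat_eq_coord (τ : O) (p : ℚ) : algebraMap ℚ (RatAlg O) p = coord τ p 0 := by
  simp [coord]

theorem one_eq_coord (τ : O) : (1 : RatAlg O) = coord τ 1 0 := by
  simp [coord]

theorem zero_eq_coord (τ : O) : (0 : RatAlg O) = coord τ 0 0 := by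
  simp [coord]

theorem coord_add (τ : O) (p q r s : ℚ) :
    coord τ p q + coord τ r s = coord τ (p + r) (q + s) := by
  simp [coord]; ring

theorem smul_coord (τ : O) (x p q : ℚ) :
    algebraMap ℚ _ x * coord τ p q = coord τ (x * p) (x * q) := by
  simp [coord]; ring

theorem algebraMap_sq {τ : O} {t n : ℤ} (e : τ ^ 2 = t * τ - n) :
    algebraMap O (RatAlg O) τ ^ 2 = algebraMap ℚ _ t * algebraMap O _ τ - algebraMap ℚ _ n := by
  rw [← map_pow, e]; simp

theorem coord_mul {τ : O} {t n : ℤ} (e : τ ^ 2 = t * τ - n) (p q r s : ℚ) :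
    coord τ p q * coord τ r s = coord τ (p * r - n * q * s) (p * s + q * r + t * q * s) := by
  simp only [coord, map_sub, map_add, map_mul]
  linear_combination (algebraMap ℚ (RatAlg O) q * algebraMap ℚ (RatAlg O) s) * algebraMap_sq e

theorem IsGen.norm_coord {τ : O} (h : IsGen τ) {t n : ℤ} (e : τ ^ 2 = t * τ - n) (p q : ℚ) :
    Algebra.norm ℚ (coord τ p q) = p ^ 2 + t * p * q + n * q ^ 2 := by
  have h0 : coord τ p q * h.ratBasis 0 = coord τ p q := by simp
  have h1 : coord τ p q * h.ratBasis 1 = coord τ (-n * q) (p + t * q) := by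
    have : h.ratBasis 1 = coord τ 0 1 := by simp [coord]
    rw [this, coord_mul e]; congr 1 <;> ring
  rw [Algebra.norm_eq_matrix_det h.ratBasis, Matrix.det_fin_two]
  simp only [Algebra.leftMulMatrix_eq_repr_mul, h0, h1, h.ratRepr]
  simp; ring

theorem IsGen.eq_zero_of_norm {τ : O} (h : IsGen τ) {t n : ℤ} (e : τ ^ 2 = t * τ - n)
    (hD : t ^ 2 - 4 * n ≠ 0) {x : RatAlg O} (hx : x ^ 3 = 0) : x = 0 := by
  obtain ⟨p, q, rfl⟩ := h.coord_surj x
  have hN : Algebra.norm ℚ (coord τ p q) = 0 := by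
    have := congrArg (Algebra.norm ℚ) hx
    rw [map_pow, zero_eq_coord τ, h.norm_coord e (0 : ℚ)] at this
    simpa using this
  rw [h.norm_coord e] at hN
  -- By Cayley-Hamilton a norm zero element satisfies `x ^ 3 = (tr x) ^ 2 • x`.
  have h2 : coord τ p q ^ 3 = algebraMap ℚ _ ((2 * p + t * q) ^ 2) * coord τ p q := by
    rw [pow_succ, pow_two, coord_mul e, coord_mul e, smul_coord, h.coord_inj]
    constructor
    · linear_combination (-3 * p - t * q) * hN
    · linear_combination (-q) * hN
  rw [hx, smul_coord, zero_eq_coord τ, h.coord_inj] at h2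
  rw [zero_eq_coord τ, h.coord_inj]
  have hD' : (t : ℚ) ^ 2 - 4 * n ≠ 0 := by exact_mod_cast hD
  rcases eq_or_ne q 0 with rfl | hq
  · simpa using hN
  · exfalso
    have h3 : (2 * p + t * q) ^ 2 = 0 := by
      have := h2.2.symm; exact (mul_eq_zero.1 this).resolve_right hq
    have h4 : ((t : ℚ) ^ 2 - 4 * n) * q ^ 2 = 0 := by linear_combination h3 - 4 * hN
    exact (mul_ne_zero hD' (pow_ne_zero 2 hq)) h4

/-! ### The norm of an ideal in terms of a basis -/

theorem IsGen.one_toAddSubgroup {τ : O} (h : IsGen τ) :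
    (1 : Submodule O (RatAlg O)).toAddSubgroup = AddSubgroup.closure {coord τ 1 0, coord τ 0 1} := by
  apply le_antisymm
  · intro x hx
    obtain ⟨y, rfl⟩ := Submodule.mem_one.1 hx
    obtain ⟨m, k, rfl⟩ := h.exists_eq y
    rw [AddSubgroup.mem_closure_pair]
    refine ⟨m, k, ?_⟩
    rw [← one_eq_coord]; simp [coord]
  · rw [AddSubgroup.closure_le]
    rintro x (rfl | rfl)
    · exact Submodule.mem_one.2 ⟨1, by simp [coord]⟩
    · exact Submodule.mem_one.2 ⟨τ, by simp [coord]⟩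

theorem closure_pair_le_mul {V : Type*} [AddCommGroup V] [Module ℚ V]
    (b₁ b₂ : Module.Basis (Fin 2) ℚ V) : ∃ N : ℕ, N ≠ 0 ∧
      ∀ i, (N : ℚ) • b₁ i ∈ AddSubgroup.closure (Set.range b₂) := by
  have key : ∀ x : V, ∃ N : ℕ, N ≠ 0 ∧ (N : ℚ) • x ∈ AddSubgroup.closure (Set.range b₂) := by
    intro x
    obtain ⟨u, v, rfl⟩ : ∃ u v, x = u • b₂ 0 + v • b₂ 1 :=
      ⟨_, _, by rw [← Fin.sum_univ_two (fun i => b₂.repr x i • b₂ i), b₂.sum_repr]⟩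
    refine ⟨u.den * v.den, by positivity, ?_⟩
    have e : ((u.den * v.den : ℕ) : ℚ) • (u • b₂ 0 + v • b₂ 1) =
        (u.num * v.den) • b₂ 0 + (v.num * u.den) • b₂ 1 := by
      rw [smul_add, smul_smul, smul_smul, ← Int.cast_smul_eq_zsmul ℚ, ← Int.cast_smul_eq_zsmul ℚ]
      congr 2
      · push_cast; linear_combination (v.den : ℚ) * Rat.mul_den_eq_num u
      · push_cast; linear_combination (u.den : ℚ) * Rat.mul_den_eq_num v
    rw [e]
    exact add_mem (zsmul_mem (AddSubgroup.subset_closure (Set.mem_range_self 0)) _)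
      (zsmul_mem (AddSubgroup.subset_closure (Set.mem_range_self 1)) _)
  obtain ⟨N, hN, h0⟩ := key (b₁ 0)
  obtain ⟨M, hM, h1⟩ := key (b₁ 1)
  refine ⟨N * M, mul_ne_zero hN hM, fun i => ?_⟩
  fin_cases i
  · have : ((N * M : ℕ) : ℚ) • b₁ 0 = M • ((N : ℚ) • b₁ 0) := by
      rw [← Nat.cast_smul_eq_nsmul ℚ, smul_smul]; push_cast; rw [mul_comm]
    exact (congrArg (· ∈ AddSubgroup.closure (Set.range b₂)) this).mpr (nsmul_mem h0 M)
  · have : ((N * M : ℕ) : ℚ) • b₁ 1 = N • ((M : ℚ) • b₁ 1) := by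
      rw [← Nat.cast_smul_eq_nsmul ℚ, smul_smul]; push_cast; rfl
    exact (congrArg (· ∈ AddSubgroup.closure (Set.range b₂)) this).mpr (nsmul_mem h1 N)

/-- The generalized index of two lattices of rank two is a determinant: both are compared with a
common sublattice `N b₁ ℤ²`. -/
theorem relIndex_div_relIndex {V : Type*} [AddCommGroup V] [Module ℚ V]
    (b₁ b₂ : Module.Basis (Fin 2) ℚ V) (L₁ L₂ : AddSubgroup V)
    (h₁ : L₁ = AddSubgroup.closure (Set.range b₁)) (h₂ : L₂ = AddSubgroup.closure (Set.range b₂)) :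
    (L₂.relIndex L₁ : ℚ) / (L₁.relIndex L₂ : ℚ) = |b₁.det b₂| := by
  obtain ⟨N, hN, hmem⟩ := closure_pair_le_mul b₁ b₂
  have hN' : (N : ℚ) ≠ 0 := by exact_mod_cast hN
  let c : Module.Basis (Fin 2) ℚ V := b₁.isUnitSMul (w := fun _ => (N : ℚ)) (fun _ => hN'.isUnit)
  have hc : ∀ i, c i = (N : ℚ) • b₁ i := fun i => b₁.isUnitSMul_apply _ i
  set M : AddSubgroup V := AddSubgroup.closure (Set.range c)
  have hM1 : M ≤ L₁ := by
    rw [h₁, AddSubgroup.closure_le]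
    rintro _ ⟨i, rfl⟩
    rw [hc, Nat.cast_smul_eq_nsmul]
    exact nsmul_mem (AddSubgroup.subset_closure (Set.mem_range_self i)) _
  have hM2 : M ≤ L₂ := by
    rw [h₂, AddSubgroup.closure_le]
    rintro _ ⟨i, rfl⟩
    rw [hc]; exact hmem i
  have e1 := AddSubgroup.relIndex_eq_abs_det M L₁ hM1 c b₁ rfl h₁
  have e2 := AddSubgroup.relIndex_eq_abs_det M L₂ hM2 c b₂ rfl h₂
  have p1 : M.relIndex (L₁ ⊓ L₂) * (L₁ ⊓ L₂).relIndex L₁ = M.relIndex L₁ :=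
    AddSubgroup.relIndex_mul_relIndex _ _ _ (le_inf hM1 hM2) inf_le_left
  have p2 : M.relIndex (L₁ ⊓ L₂) * (L₁ ⊓ L₂).relIndex L₂ = M.relIndex L₂ :=
    AddSubgroup.relIndex_mul_relIndex _ _ _ (le_inf hM1 hM2) inf_le_right
  rw [AddSubgroup.inf_relIndex_left] at p1
  rw [AddSubgroup.inf_relIndex_right] at p2
  have hd : b₁.det c = b₁.det b₂ * b₂.det c := (Module.Basis.det_mul_det b₁ b₂ c).symm
  have hu : |b₂.det c| ≠ 0 := abs_ne_zero.2 (b₂.isUnit_det c).ne_zero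
  rw [hd, abs_mul, ← p1] at e1
  rw [← p2] at e2
  push_cast at e1 e2
  rw [← e2] at hu e1
  have hm := left_ne_zero_of_mul hu
  have hr := right_ne_zero_of_mul hu
  rw [div_eq_iff hr]
  apply mul_left_cancel₀ hm
  rw [e1]; ring

/-- The norm of the ideal with `ℤ`-basis `p + q τ, r + s τ` is `|p s - q r|`. -/
theorem IsGen.idealNorm_eq {τ : O} (h : IsGen τ) (I : Submodule O (RatAlg O)) {p q r s : ℚ}
    (hI : I.toAddSubgroup = AddSubgroup.closure {coord τ p q, coord τ r s})
    (hd : p * s - q * r ≠ 0) : idealNorm I = |p * s - q * r| := by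
  have hli : LinearIndependent ℚ ![coord τ p q, coord τ r s] := by
    rw [LinearIndependent.pair_iff]
    intro x y e
    rw [Algebra.smul_def, Algebra.smul_def, smul_coord, smul_coord, coord_add, zero_eq_coord τ,
      h.coord_inj] at e
    obtain ⟨e1, e2⟩ := e
    constructor
    · apply mul_right_cancel₀ hd; linear_combination s * e1 - r * e2
    · apply mul_right_cancel₀ hd; linear_combination p * e2 - q * e1
  let b : Module.Basis (Fin 2) ℚ (RatAlg O) := basisOfLinearIndependentOfCardEqFinrank hli
    (by rw [Module.finrank_eq_card_basis h.ratBasis])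
  have hb : (b : Fin 2 → RatAlg O) = ![coord τ p q, coord τ r s] :=
    coe_basisOfLinearIndependentOfCardEqFinrank _ _
  have hb' : (h.ratBasis : Fin 2 → RatAlg O) = ![coord τ 1 0, coord τ 0 1] := by
    ext i; fin_cases i <;> simp [coord]
  rw [idealNorm, relIndex_div_relIndex h.ratBasis b _ _ (by rw [h.one_toAddSubgroup, hb']; simp [Set.pair_comm])
    (by rw [hI, hb]; simp [Set.pair_comm])]
  congr 1
  rw [Module.Basis.det_apply, Matrix.det_fin_two]
  simp only [Module.Basis.toMatrix_apply, hb, Matrix.cons_val_zero, Matrix.cons_val_one, h.ratRepr]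
  simp; ring

end

/-! ### Reducible forms under `SL₂(ℤ)` -/

namespace CubicForm

/-- The form `f(p x + r y, q x + s y)`. -/
def act (f : CubicForm) (p q r s : ℤ) : CubicForm where
  a := f.a * p ^ 3 + 3 * f.b * p ^ 2 * q + 3 * f.c * p * q ^ 2 + f.d * q ^ 3
  b := f.a * p ^ 2 * r + f.b * (p ^ 2 * s + 2 * p * q * r) + f.c * (q ^ 2 * r + 2 * p * q * s)
    + f.d * q ^ 2 * s
  c := f.a * p * r ^ 2 + f.b * (r ^ 2 * q + 2 * p * r * s) + f.c * (s ^ 2 * p + 2 * q * r * s)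
    + f.d * q * s ^ 2
  d := f.a * r ^ 3 + 3 * f.b * r ^ 2 * s + 3 * f.c * r * s ^ 2 + f.d * s ^ 3

theorem eval_act {R : Type*} [CommRing R] (f : CubicForm) (p q r s : ℤ) (x y : R) :
    (f.act p q r s).eval x y = f.eval (x * p + y * r) (x * q + y * s) := by
  simp only [eval, act]; push_cast; ring

theorem ext_eval {f g : CubicForm} (h : ∀ x y : ℤ, f.eval x y = g.eval x y) : f = g := by
  have h1 := h 1 0
  have h2 := h 0 1
  have h3 := h 1 1
  have h4 := h 1 (-1)
  simp [eval] at h1 h2 h3 h4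
  ext <;> linarith

theorem equivalent_iff {f g : CubicForm} : f.Equivalent g ↔
    ∃ p q r s : ℤ, p * s - q * r = 1 ∧ g = f.act p q r s := by
  constructor
  · rintro ⟨γ, h⟩
    refine ⟨γ.1 0 0, γ.1 0 1, γ.1 1 0, γ.1 1 1, ?_, ext_eval fun x y => ?_⟩
    · rw [← Matrix.det_fin_two]; exact γ.2
    · rw [h, eval_act]; rfl
  · rintro ⟨p, q, r, s, h, rfl⟩
    refine ⟨⟨!![p, q; r, s], by rw [Matrix.det_fin_two_of]; exact h⟩, fun x y => ?_⟩
    rw [eval_act]; rfl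

theorem equivalent_act (f : CubicForm) {p q r s : ℤ} (h : p * s - q * r = 1) :
    f.Equivalent (f.act p q r s) := equivalent_iff.2 ⟨p, q, r, s, h, rfl⟩

theorem disc_act (f : CubicForm) (p q r s : ℤ) :
    (f.act p q r s).disc = (p * s - q * r) ^ 6 * f.disc := by
  simp only [disc, act]; ring

theorem Equivalent.disc_eq {f g : CubicForm} (h : f.Equivalent g) : g.disc = f.disc := by
  obtain ⟨p, q, r, s, hd, rfl⟩ := equivalent_iff.1 h
  rw [disc_act, hd]; ring

/-- The form `3 b x² y + 3 c x y² + d y³` is divisible by `y`. -/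
theorem isReducible_of_a_eq_zero {f : CubicForm} (h : f.a = 0) : f.IsReducible :=
  ⟨0, 1, 3 * f.b, 3 * f.c, f.d, fun x y => by simp [eval, h]; ring⟩

theorem disc_of_a_eq_zero {f : CubicForm} (h : f.a = 0) :
    f.disc = f.b ^ 2 * (4 * f.b * f.d - 3 * f.c ^ 2) := by
  simp only [disc, h]; ring

theorem IsReducible.exists_root {f : CubicForm} (hf : f.IsReducible) (hD : f.disc ≠ 0) :
    ∃ p q : ℤ, IsCoprime p q ∧ f.eval p q = 0 := by
  obtain ⟨k, l, m, n, o, h⟩ := hf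
  have hkl : k ≠ 0 ∨ l ≠ 0 := by
    by_contra! hc
    apply hD
    have h0 : f = ⟨0, 0, 0, 0⟩ := ext_eval fun x y => by
      have := h x y
      simp only [hc.1, hc.2, eval] at this ⊢
      have h' : ((f.a * x ^ 3 + 3 * f.b * x ^ 2 * y + 3 * f.c * x * y ^ 2 + f.d * y ^ 3 : ℤ) : ℚ)
        = 0 := by push_cast; rw [this]; ring
      have := Int.cast_eq_zero.1 h'
      simpa using this
    rw [h0]; simp [disc]
  -- clear denominators in the root `(l, -k)`
  obtain ⟨u, v, w, hw, hu, hv, huv⟩ : ∃ u v w : ℤ, w ≠ 0 ∧ (u : ℚ) = w * l ∧ (v : ℚ) = w * (-k) ∧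
      (u ≠ 0 ∨ v ≠ 0) := by
    refine ⟨l.num * k.den, -(k.num * l.den), l.den * k.den, by positivity, ?_, ?_, ?_⟩
    · push_cast; linear_combination -(k.den : ℚ) * Rat.mul_den_eq_num l
    · push_cast; linear_combination (l.den : ℚ) * Rat.mul_den_eq_num k
    · rcases hkl with hk | hl
      · right; simp [hk]
      · left; simp [hl]
  have huv0 : f.eval u v = 0 := by
    have := h u v
    have h' : ((f.eval u v : ℤ) : ℚ) = f.eval (u : ℚ) (v : ℚ) := by simp [eval]
    rw [this, hu, hv] at h'
    have : ((f.eval u v : ℤ) : ℚ) = 0 := by rw [h']; ring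
    exact_mod_cast this
  have hg : 0 < Int.gcd u v := by
    rw [Int.gcd_pos_iff]; exact huv
  obtain ⟨g, p, q, hg0, hcop, rfl, rfl⟩ := Int.exists_gcd_one' hg
  refine ⟨p, q, Int.isCoprime_iff_gcd_eq_one.2 hcop, ?_⟩
  have : (g : ℤ) ^ 3 * f.eval p q = 0 := by rw [← huv0]; simp only [eval]; push_cast; ring
  exact (mul_eq_zero.1 this).resolve_left (by positivity)

/-- The normal forms of reducible forms under `SL₂(ℤ)`. -/
structure IsReduced (f : CubicForm) : Prop where
  a_eq : f.a = 0
  b_pos : 0 < f.b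
  c_nonneg : 0 ≤ f.c
  c_lt : f.c < 2 * f.b

theorem exists_isReduced_of_a_eq_zero {f : CubicForm} (ha : f.a = 0) (hb : f.b ≠ 0) :
    ∃ g, f.Equivalent g ∧ g.IsReduced := by
  obtain ⟨g, hg, hga, hgb⟩ : ∃ g, f.Equivalent g ∧ g.a = 0 ∧ 0 < g.b := by
    rcases lt_or_gt_of_ne hb with h | h
    · exact ⟨f.act (-1) 0 0 (-1), f.equivalent_act (by norm_num), by simp [act, ha],
        by simp [act]; omega⟩
    · exact ⟨f, equivalent_refl f, ha, h⟩
  have h2 : (0 : ℤ) < 2 * g.b := by omega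
  refine ⟨g.act 1 0 (-(g.c / (2 * g.b))) 1, equivalent_trans hg (g.equivalent_act (by norm_num)),
    ⟨by simp [act, hga], by simpa [act, hga] using hgb, ?_, ?_⟩⟩
  · have : (g.act 1 0 (-(g.c / (2 * g.b))) 1).c = g.c % (2 * g.b) := by
      rw [Int.emod_def]; simp only [act, hga]; ring
    rw [this]; exact Int.emod_nonneg _ h2.ne'
  · have : (g.act 1 0 (-(g.c / (2 * g.b))) 1).c = g.c % (2 * g.b) := by
      rw [Int.emod_def]; simp only [act, hga]; ring
    have hb' : (g.act 1 0 (-(g.c / (2 * g.b))) 1).b = g.b := by simp [act, hga]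
    rw [this, hb']; exact Int.emod_lt_of_pos _ h2

theorem IsReducible.exists_isReduced {f : CubicForm} (hf : f.IsReducible) (hD : f.disc ≠ 0) :
    ∃ g, f.Equivalent g ∧ g.IsReduced := by
  obtain ⟨p, q, ⟨s, r, hsr⟩, h0⟩ := hf.exists_root hD
  have hd : p * s - q * (-r) = 1 := by linarith
  have hE := f.equivalent_act hd
  have ha : (f.act p q (-r) s).a = 0 := by simpa [act, eval] using h0
  have hb : (f.act p q (-r) s).b ≠ 0 := by
    intro hb
    apply hD
    rw [← hE.disc_eq, disc_of_a_eq_zero ha, hb]; ring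
  obtain ⟨g, hg, hr⟩ := exists_isReduced_of_a_eq_zero ha hb
  exact ⟨g, equivalent_trans hE hg, hr⟩

/-- A second rational linear factor makes `-3 D` a square, so in the absence of such a factor the
reduced form is unique. -/
theorem IsReduced.eq_of_equivalent {f g : CubicForm} (hf : f.IsReduced) (hg : g.IsReduced)
    (h : f.Equivalent g) (hs : ¬ IsSquare (-3 * f.disc)) : f = g := by
  obtain ⟨p, q, r, s, hd, rfl⟩ := equivalent_iff.1 h
  have hfb := hf.b_pos
  have hgb := hg.b_pos
  have hga := hg.a_eq
  rcases eq_or_ne q 0 with rfl | hq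
  · have hps : p * s = 1 := by linarith
    have hp2 : p * p = 1 := by
      rcases Int.eq_one_or_neg_one_of_mul_eq_one hps with rfl | rfl <;> norm_num
    have hbs : 0 < f.b * s := by
      have : (f.act p 0 r s).b = f.b * s := by
        simp only [act, hf.a_eq]; linear_combination f.b * s * hp2
      rwa [this] at hgb
    have hs0 : 0 < s := pos_of_mul_pos_right hbs hfb.le
    have hs1 : s = 1 := by
      rcases Int.eq_one_or_neg_one_of_mul_eq_one' hps with h | h <;> omega
    subst hs1
    have hp1 : p = 1 := by linarith
    subst hp1
    have hc : (f.act 1 0 r 1).c = f.c + 2 * f.b * r := by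
      simp only [act, hf.a_eq]; ring
    have hb : (f.act 1 0 r 1).b = f.b := by
      simp only [act, hf.a_eq]; ring
    have h1 := hg.c_nonneg
    have h2 := hg.c_lt
    have h3 := hf.c_nonneg
    have h4 := hf.c_lt
    rw [hc] at h1 h2
    rw [hb] at h2
    have hr : r = 0 := by
      by_contra hr
      rcases lt_or_gt_of_ne hr with h | h
      · nlinarith
      · nlinarith
    subst hr
    ext <;> simp [act]
  · exfalso
    apply hs
    have hquad : 3 * f.b * p ^ 2 + 3 * f.c * p * q + f.d * q ^ 2 = 0 := by
      have : q * (3 * f.b * p ^ 2 + 3 * f.c * p * q + f.d * q ^ 2) = 0 := by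
        rw [← hga]; simp only [act, hf.a_eq]; ring
      exact (mul_eq_zero.1 this).resolve_left hq
    have hsq : (3 * f.b * (2 * f.b * p + f.c * q)) ^ 2 = q ^ 2 * (-3 * f.disc) := by
      rw [disc_of_a_eq_zero hf.a_eq]
      linear_combination 12 * f.b ^ 3 * hquad
    have hdvd : q ∣ 3 * f.b * (2 * f.b * p + f.c * q) :=
      (Int.pow_dvd_pow_iff two_ne_zero).1 (Dvd.intro _ hsq.symm)
    obtain ⟨k, hk⟩ := hdvd
    refine ⟨k, ?_⟩
    rw [hk] at hsq
    apply mul_left_cancel₀ (pow_ne_zero 2 hq)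
    rw [← hsq]; ring

end CubicForm

section
variable {O : Type*} [CommRing O]

namespace Triple

theorem Corresponds.of_equivalent {π : Orientation O} {T : Triple O} {f g : CubicForm}
    (h : T.Corresponds π f) (hfg : f.Equivalent g) : T.Corresponds π g := by
  obtain ⟨τ, hτ, α, β, hI, ⟨k, l, m, n, hα, hβ, hdet⟩, e₀, e₁, e₂, e₃, h0, h1, h2, h3⟩ := h
  obtain ⟨p, q, r, s, hd, rfl⟩ := CubicForm.equivalent_iff.1 hfg
  refine ⟨τ, hτ, (p : RatAlg O) * α + q * β, (r : RatAlg O) * α + s * β, ?_,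
    ⟨p * k + q * m, p * l + q * n, r * k + s * m, r * l + s * n, ?_, ?_, ?_⟩,
    (⟨e₀, e₁, e₂, e₃⟩ : CubicForm).act p q r s |>.a, (⟨e₀, e₁, e₂, e₃⟩ : CubicForm).act p q r s |>.b,
    (⟨e₀, e₁, e₂, e₃⟩ : CubicForm).act p q r s |>.c, (⟨e₀, e₁, e₂, e₃⟩ : CubicForm).act p q r s |>.d,
    ?_, ?_, ?_, ?_⟩
  · rw [hI]
    apply le_antisymm
    · rw [AddSubgroup.closure_le]
      rintro x (rfl | rfl)
      · refine AddSubgroup.mem_closure_pair.2 ⟨s, -q, ?_⟩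
        simp only [zsmul_eq_mul]; push_cast
        have : (p * s - q * r : RatAlg O) = 1 := by
          exact_mod_cast congrArg (Int.cast : ℤ → RatAlg O) hd
        linear_combination x * this
      · refine AddSubgroup.mem_closure_pair.2 ⟨-r, p, ?_⟩
        simp only [zsmul_eq_mul]; push_cast
        have : (p * s - q * r : RatAlg O) = 1 := by
          exact_mod_cast congrArg (Int.cast : ℤ → RatAlg O) hd
        linear_combination x * this
    · rw [AddSubgroup.closure_le]
      rintro x (rfl | rfl)
      · exact AddSubgroup.mem_closure_pair.2 ⟨p, q, by simp⟩
      · exact AddSubgroup.mem_closure_pair.2 ⟨r, s, by simp⟩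
  · rw [hα, hβ]; simp only [map_add, map_mul, map_intCast]; ring
  · rw [hα, hβ]; simp only [map_add, map_mul, map_intCast]; ring
  · have hd' : (p * s - q * r : ℚ) = 1 := by exact_mod_cast hd
    calc (0 : ℚ) < (p * s - q * r) * (k * n - l * m) := by rw [hd', one_mul]; exact hdet
      _ = _ := by ring
  all_goals
    simp only [CubicForm.act, map_add, map_mul, map_intCast] at h0 h1 h2 h3 ⊢
    push_cast
  · linear_combination (p : RatAlg O) ^ 3 * h0 + 3 * (p : RatAlg O) ^ 2 * q * h1 +
      3 * (p : RatAlg O) * q ^ 2 * h2 + (q : RatAlg O) ^ 3 * h3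
  · linear_combination (p : RatAlg O) ^ 2 * r * h0 + ((p : RatAlg O) ^ 2 * s + 2 * p * q * r) * h1 +
      ((q : RatAlg O) ^ 2 * r + 2 * p * q * s) * h2 + (q : RatAlg O) ^ 2 * s * h3
  · linear_combination (p : RatAlg O) * r ^ 2 * h0 + ((r : RatAlg O) ^ 2 * q + 2 * p * r * s) * h1 +
      ((s : RatAlg O) ^ 2 * p + 2 * q * r * s) * h2 + (q : RatAlg O) * s ^ 2 * h3
  · linear_combination (r : RatAlg O) ^ 3 * h0 + 3 * (r : RatAlg O) ^ 2 * s * h1 +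
      3 * (r : RatAlg O) * s ^ 2 * h2 + (s : RatAlg O) ^ 3 * h3

theorem toAddSubgroup_span_singleton_mul (κ : RatAlg O) (I : Submodule O (RatAlg O))
    {α β : RatAlg O} (hI : I.toAddSubgroup = AddSubgroup.closure {α, β}) :
    (Submodule.span O {κ} * I).toAddSubgroup = AddSubgroup.closure {κ * α, κ * β} := by
  have hmem : ∀ x, x ∈ I ↔ x ∈ AddSubgroup.closure {α, β} := fun x => by rw [← hI]; rfl
  ext x
  change x ∈ Submodule.span O {κ} * I ↔ _
  rw [Submodule.mem_span_singleton_mul, AddSubgroup.mem_closure_pair]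
  constructor
  · rintro ⟨y, hy, rfl⟩
    rw [hmem, AddSubgroup.mem_closure_pair] at hy
    obtain ⟨m, n, rfl⟩ := hy
    exact ⟨m, n, by simp only [zsmul_eq_mul]; ring⟩
  · rintro ⟨m, n, rfl⟩
    exact ⟨m • α + n • β, (hmem _).2 (AddSubgroup.mem_closure_pair.2 ⟨m, n, rfl⟩),
      by simp only [zsmul_eq_mul]; ring⟩

/-- Forms that correspond to the same triple are equivalent: the two positively oriented bases of
`I` differ by an element of `SL₂(ℤ)`. -/
theorem Corresponds.equivalent [IsQuadraticRing O] {π : Orientation O} {T : Triple O}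
    {f g : CubicForm} (hf : T.Corresponds π f) (hg : T.Corresponds π g) : f.Equivalent g := by
  obtain ⟨τ, hτ, α, β, hI, ⟨k, l, m, n, hα, hβ, hdet⟩, e₀, e₁, e₂, e₃, h0, h1, h2, h3⟩ := hf
  obtain ⟨σ, hσ, α', β', hI', ⟨k', l', m', n', hα', hβ', hdet'⟩, e₀', e₁', e₂', e₃',
    h0', h1', h2', h3'⟩ := hg
  obtain ⟨z, rfl⟩ := IsGen.orientation_eq π hτ hσ
  have h := isGen_of_orientation π hτ
  have hc : AddSubgroup.closure {α, β} = AddSubgroup.closure {α', β'} := by rw [← hI, hI']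
  have mem1 : α' ∈ AddSubgroup.closure {α, β} := by
    rw [hc]; exact AddSubgroup.subset_closure (by simp)
  have mem2 : β' ∈ AddSubgroup.closure {α, β} := by
    rw [hc]; exact AddSubgroup.subset_closure (by simp)
  have mem3 : α ∈ AddSubgroup.closure {α', β'} := by
    rw [← hc]; exact AddSubgroup.subset_closure (by simp)
  have mem4 : β ∈ AddSubgroup.closure {α', β'} := by
    rw [← hc]; exact AddSubgroup.subset_closure (by simp)
  obtain ⟨p, q, rfl⟩ := AddSubgroup.mem_closure_pair.1 mem1
  obtain ⟨r, s, rfl⟩ := AddSubgroup.mem_closure_pair.1 mem2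
  obtain ⟨p', q', hp'⟩ := AddSubgroup.mem_closure_pair.1 mem3
  obtain ⟨r', s', hr'⟩ := AddSubgroup.mem_closure_pair.1 mem4
  replace hα : α = coord τ k l := hα
  replace hβ : β = coord τ m n := hβ
  have toC : ∀ (u v : ℤ) (a b c d : ℚ), u • coord τ a b + v • coord τ c d =
      coord τ (u * a + v * c) (u * b + v * d) := by
    intro u v a b c d
    simp only [zsmul_eq_mul, coord, map_add, map_mul, map_intCast]; ring
  have toσ : ∀ u v : ℚ, algebraMap ℚ (RatAlg O) u + algebraMap ℚ (RatAlg O) v *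
      algebraMap O (RatAlg O) (z + τ) = coord τ (u + v * z) v := by
    intro u v
    simp only [coord, map_add, map_mul, map_intCast]; ring
  rw [hα, hβ, toC, toσ, h.coord_inj] at hα' hβ'
  rw [hα, hβ, toC, toC, toC, h.coord_inj] at hp' hr'
  obtain ⟨a1, a2⟩ := hα'
  obtain ⟨b1, b2⟩ := hβ'
  obtain ⟨c1, c2⟩ := hp'
  obtain ⟨d1, d2⟩ := hr'
  have hpos : (0 : ℚ) < p * s - q * r := by
    have : (0 : ℚ) < (p * s - q * r) * (k * n - l * m) := by
      calc (0 : ℚ) < k' * n' - l' * m' := hdet'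
        _ = (k' + l' * z) * n' - l' * (m' + n' * z) := by ring
        _ = _ := by rw [← a1, ← a2, ← b1, ← b2]; ring
    exact pos_of_mul_pos_left this hdet.le
  have hmul : ((p' * s' - q' * r' : ℤ) : ℚ) * (p * s - q * r : ℤ) = 1 := by
    apply mul_right_cancel₀ hdet.ne'
    push_cast
    calc ((p' * s' - q' * r' : ℚ)) * (p * s - q * r) * (k * n - l * m) =
        (p' * (p * k + q * m) + q' * (r * k + s * m)) * (r' * (p * l + q * n) + s' * (r * l + s * n)) -
        (p' * (p * l + q * n) + q' * (r * l + s * n)) * (r' * (p * k + q * m) + s' * (r * k + s * m)) := by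
          ring
      _ = _ := by rw [c1, c2, d1, d2]; ring
  have hpos' : 0 < p * s - q * r := by exact_mod_cast hpos
  have hmul' : (p' * s' - q' * r') * (p * s - q * r) = 1 := by exact_mod_cast hmul
  have hd1 : p * s - q * r = 1 := by
    rcases Int.eq_one_or_neg_one_of_mul_eq_one' hmul' with h | h <;> omega
  refine CubicForm.equivalent_iff.2 ⟨p, q, r, s, hd1, ?_⟩
  have cancel : ∀ u v u' v' : ℤ, (T.δ : RatAlg O) * algebraMap O _ (u + v * (z + τ)) =
      T.δ * algebraMap O _ (u' + v' * τ) → v = v' := by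
    intro u v u' v' e
    have e' := T.δ.isUnit.mul_left_cancel e
    have h5 : (u : O) + v * (z + τ) = ((u + v * z : ℤ) : O) + v * τ := by push_cast; ring
    rw [h5, algebraMap_eq_coord, algebraMap_eq_coord, h.coord_inj] at e'
    exact_mod_cast e'.2
  simp only [zsmul_eq_mul] at h0' h1' h2' h3'
  ext
  · apply cancel e₀' _ ((⟨e₀, e₁, e₂, e₃⟩ : CubicForm).act p q r s |>.a)
    rw [← h0']
    simp only [CubicForm.act, map_add, map_mul, map_intCast] at h0 h1 h2 h3 ⊢
    push_cast
    linear_combination (p : RatAlg O) ^ 3 * h0 + 3 * (p : RatAlg O) ^ 2 * q * h1 +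
      3 * (p : RatAlg O) * q ^ 2 * h2 + (q : RatAlg O) ^ 3 * h3
  · apply cancel e₁' _ ((⟨e₀, e₁, e₂, e₃⟩ : CubicForm).act p q r s |>.b)
    rw [← h1']
    simp only [CubicForm.act, map_add, map_mul, map_intCast] at h0 h1 h2 h3 ⊢
    push_cast
    linear_combination (p : RatAlg O) ^ 2 * r * h0 + ((p : RatAlg O) ^ 2 * s + 2 * p * q * r) * h1 +
      ((q : RatAlg O) ^ 2 * r + 2 * p * q * s) * h2 + (q : RatAlg O) ^ 2 * s * h3
  · apply cancel e₂' _ ((⟨e₀, e₁, e₂, e₃⟩ : CubicForm).act p q r s |>.c)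
    rw [← h2']
    simp only [CubicForm.act, map_add, map_mul, map_intCast] at h0 h1 h2 h3 ⊢
    push_cast
    linear_combination (p : RatAlg O) * r ^ 2 * h0 + ((r : RatAlg O) ^ 2 * q + 2 * p * r * s) * h1 +
      ((s : RatAlg O) ^ 2 * p + 2 * q * r * s) * h2 + (q : RatAlg O) * s ^ 2 * h3
  · apply cancel e₃' _ ((⟨e₀, e₁, e₂, e₃⟩ : CubicForm).act p q r s |>.d)
    rw [← h3']
    simp only [CubicForm.act, map_add, map_mul, map_intCast] at h0 h1 h2 h3 ⊢
    push_cast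
    linear_combination (r : RatAlg O) ^ 3 * h0 + 3 * (r : RatAlg O) ^ 2 * s * h1 +
      3 * (r : RatAlg O) * s ^ 2 * h2 + (s : RatAlg O) ^ 3 * h3

/-- The correspondence only depends on the class of the triple. If `I' = κ I` and `δ' = κ³ δ`, then
`N(κ)³ = |N(κ)|³` by the norm condition, so multiplication by `κ` preserves the orientation. -/
theorem Corresponds.of_triple_equivalent [IsQuadraticRing O] {π : Orientation O} {T T' : Triple O}
    {f : CubicForm} (hf : T.Corresponds π f) (hT : T.Equivalent T') : T'.Corresponds π f := by
  obtain ⟨τ, hτ, α, β, hI, ⟨k, l, m, n, hα, hβ, hdet⟩, e₀, e₁, e₂, e₃, h0, h1, h2, h3⟩ := hf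
  obtain ⟨κ, hκI, hκδ⟩ := hT
  have h := isGen_of_orientation π hτ
  obtain ⟨t, w, hsq⟩ := h.exists_sq
  have hI' := toAddSubgroup_span_singleton_mul (κ : RatAlg O) T.I hI
  rw [← hκI] at hI'
  replace hα : α = coord τ k l := hα
  replace hβ : β = coord τ m n := hβ
  obtain ⟨u, v, huv⟩ := h.coord_surj (κ : RatAlg O)
  have eα : (κ : RatAlg O) * α = coord τ (u * k - w * v * l) (u * l + v * k + t * v * l) := by
    rw [huv, hα, coord_mul hsq]
  have eβ : (κ : RatAlg O) * β = coord τ (u * m - w * v * n) (u * n + v * m + t * v * n) := by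
    rw [huv, hβ, coord_mul hsq]
  have hN := h.norm_coord hsq u v
  rw [← huv] at hN
  have hN0 : Algebra.norm ℚ (κ : RatAlg O) ≠ 0 := (κ.isUnit.map (Algebra.norm ℚ)).ne_zero
  have hdet2 : (u * k - w * v * l) * (u * n + v * m + t * v * n) -
      (u * l + v * k + t * v * l) * (u * m - w * v * n) =
      Algebra.norm ℚ (κ : RatAlg O) * (k * n - l * m) := by rw [hN]; ring
  have hne : Algebra.norm ℚ (κ : RatAlg O) * (k * n - l * m) ≠ 0 := mul_ne_zero hN0 hdet.ne'
  have n1 := h.idealNorm_eq T.I (by rw [hI, hα, hβ]) hdet.ne'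
  have n2 := h.idealNorm_eq T'.I (by rw [hI', eα, eβ]) (by rw [hdet2]; exact hne)
  rw [hdet2, abs_mul, abs_of_pos hdet] at n2
  rw [abs_of_pos hdet] at n1
  have n3 := T.norm_eq
  have n4 := T'.norm_eq
  rw [hκδ, Units.val_mul, Units.val_pow_eq_pow_val, map_mul, map_pow, ← n3, n1, n2] at n4
  have hNpos : 0 < Algebra.norm ℚ (κ : RatAlg O) := by
    have h5 : |Algebra.norm ℚ (κ : RatAlg O)| ^ 3 = Algebra.norm ℚ (κ : RatAlg O) ^ 3 := by
      apply mul_right_cancel₀ (pow_pos hdet 3).ne'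
      rw [← n4]; ring
    have h6 : 0 < Algebra.norm ℚ (κ : RatAlg O) ^ 3 := by
      rw [← h5]; exact pow_pos (abs_pos.2 hN0) 3
    exact (Odd.pow_pos_iff (by decide : Odd 3)).1 h6
  refine ⟨τ, hτ, κ * α, κ * β, hI', ⟨_, _, _, _, eα, eβ, ?_⟩, e₀, e₁, e₂, e₃, ?_, ?_, ?_, ?_⟩
  · rw [hdet2]; exact mul_pos hNpos hdet
  all_goals rw [hκδ, Units.val_mul, Units.val_pow_eq_pow_val]
  · linear_combination (κ : RatAlg O) ^ 3 * h0
  · linear_combination (κ : RatAlg O) ^ 3 * h1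
  · linear_combination (κ : RatAlg O) ^ 3 * h2
  · linear_combination (κ : RatAlg O) ^ 3 * h3

theorem IsProjective.of_equivalent {T T' : Triple O} (h : T.IsProjective) (hT : T.Equivalent T') :
    T'.IsProjective := by
  obtain ⟨κ, hκI, -⟩ := hT
  rw [IsProjective, hκI]
  refine IsUnit.mul (IsUnit.of_mul_eq_one (Submodule.span O {((κ⁻¹ : (RatAlg O)ˣ) : RatAlg O)}) ?_) h
  rw [Submodule.span_mul_span, Set.singleton_mul_singleton, Units.mul_inv, ← Submodule.one_eq_span]

end Triple
end

/-! ### The normal form of a triple -/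

section
variable {O : Type*} [CommRing O]

namespace Triple

/-- The normal form of the triple of a form `3 b x² y + 3 c x y² + d y³`: after scaling, `δ = 1`
and `I = ℤ b + ℤ θ / b` with `θ² = b c θ - b² (c² - b d)`. Indeed `α³ = e₀ δ` makes `α` a unit, so
one may scale to `α = b`; then the norm condition forces `e₀ = b³`, and the two remaining
equations determine `β`. -/
theorem Corresponds.normalForm [IsQuadraticRing O] (hD : ringDisc O ≠ 0) {π : Orientation O}
    {T : Triple O} {f : CubicForm} (hf : T.Corresponds π f) (ha : f.a = 0) :
    f.b ≠ 0 ∧ ∃ θ : O, π (Submodule.Quotient.mk θ) = 1 ∧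
      θ ^ 2 = ((f.b * f.c : ℤ) : O) * θ - ((f.b ^ 2 * (f.c ^ 2 - f.b * f.d) : ℤ) : O) ∧
      ∃ κ : (RatAlg O)ˣ, T.I.toAddSubgroup = AddSubgroup.closure
          {κ * coord θ f.b 0, κ * coord θ 0 (f.b : ℚ)⁻¹} ∧ T.δ = κ ^ 3 := by
  obtain ⟨τ, hτ, α, β, hI, ⟨k, l, m, n, hα, hβ, hdet⟩, e₀, e₁, e₂, e₃, h0, h1, h2, h3⟩ := hf
  have h := isGen_of_orientation π hτ
  obtain ⟨t, w, hsq⟩ := h.exists_sq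
  rw [h.ringDisc_eq hsq] at hD
  replace hα : α = coord τ k l := hα
  replace hβ : β = coord τ m n := hβ
  obtain ⟨a, b, c, d⟩ := f
  simp only at ha h0 h1 h2 h3 ⊢
  subst ha
  rw [algebraMap_eq_coord] at h0 h1 h2 h3
  rw [Int.cast_zero] at h0
  have hα0 : α ≠ 0 := by
    rintro rfl
    rw [zero_eq_coord τ, h.coord_inj] at hα
    rw [← hα.1, ← hα.2] at hdet; simp at hdet
  -- `e₀ ≠ 0` because the algebra is reduced
  have he0 : (e₀ : ℚ) ≠ 0 := by
    intro he
    rw [he, ← zero_eq_coord, mul_zero] at h0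
    exact hα0 (h.eq_zero_of_norm hsq hD h0)
  rw [← algebraMap_rat_eq_coord] at h0
  have hα_unit : IsUnit α := by
    rw [← isUnit_pow_iff three_ne_zero, h0]
    exact T.δ.isUnit.mul ((isUnit_iff_ne_zero.2 he0).map _)
  -- `e₀ β = α (e₁ + b τ)`
  have hβα : algebraMap ℚ _ (e₀ : ℚ) * β = α * coord τ e₁ b := by
    apply (hα_unit.pow 2).mul_left_cancel
    linear_combination algebraMap ℚ (RatAlg O) e₀ * h1 - coord τ e₁ b * h0
  have hNα := h.norm_coord hsq k l
  rw [← hα] at hNα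
  have hcoord := hβα
  rw [hβ, hα, smul_coord, coord_mul hsq, h.coord_inj] at hcoord
  have hdetN : e₀ * (k * n - l * m) = Algebra.norm ℚ α * b := by
    rw [hNα]; linear_combination k * hcoord.2 - l * hcoord.1
  have hNα0 : Algebra.norm ℚ α ≠ 0 := (hα_unit.map (Algebra.norm ℚ)).ne_zero
  have hb : (b : ℚ) ≠ 0 := by
    intro hb
    rw [hb, mul_zero] at hdetN
    exact mul_ne_zero he0 hdet.ne' hdetN
  have hb' : b ≠ 0 := by exact_mod_cast hb
  -- the norm condition
  have hI2 := hI
  rw [hα, hβ] at hI2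
  have n1 := h.idealNorm_eq T.I hI2 hdet.ne'
  rw [abs_of_pos hdet] at n1
  have n2 := T.norm_eq
  rw [n1] at n2
  have n3 := congrArg (Algebra.norm ℚ) h0
  rw [map_pow, map_mul, ← n2, algebraMap_rat_eq_coord τ, h.norm_coord hsq] at n3
  have he0b : (e₀ : ℚ) = b ^ 3 := by
    have n4 : Algebra.norm ℚ α ^ 3 * e₀ = Algebra.norm ℚ α ^ 3 * b ^ 3 := by
      calc Algebra.norm ℚ α ^ 3 * e₀ = (e₀ * (k * n - l * m)) ^ 3 := by rw [n3]; ring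
        _ = _ := by rw [hdetN]; ring
    exact mul_left_cancel₀ (pow_ne_zero 3 hNα0) n4
  rw [he0b] at h0 hβα
  -- the equation for `α β²` determines the trace and norm of `e₁ + b τ`
  have h2' : coord τ e₁ b ^ 2 = algebraMap ℚ _ ((b : ℚ) ^ 3) * coord τ e₂ c := by
    have hu : IsUnit (α ^ 3) := hα_unit.pow 3
    apply hu.mul_left_cancel
    have e1 : (algebraMap ℚ (RatAlg O) ((b : ℚ) ^ 3) * β) ^ 2 = (α * coord τ e₁ b) ^ 2 := by
      rw [hβα]
    linear_combination -α * e1 + algebraMap ℚ (RatAlg O) ((b : ℚ) ^ 3) ^ 2 * h2 -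
      algebraMap ℚ (RatAlg O) ((b : ℚ) ^ 3) * coord τ e₂ c * h0
  have h3' : coord τ e₁ b ^ 3 = algebraMap ℚ _ ((b : ℚ) ^ 6) * coord τ e₃ d := by
    have hu : IsUnit (α ^ 3) := hα_unit.pow 3
    apply hu.mul_left_cancel
    have e1 : (algebraMap ℚ (RatAlg O) ((b : ℚ) ^ 3) * β) ^ 3 = (α * coord τ e₁ b) ^ 3 := by
      rw [hβα]
    have e2 : algebraMap ℚ (RatAlg O) ((b : ℚ) ^ 6) = algebraMap ℚ (RatAlg O) ((b : ℚ) ^ 3) ^ 2 := by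
      rw [← map_pow]; congr 1; ring
    rw [e2]
    linear_combination -e1 + algebraMap ℚ (RatAlg O) ((b : ℚ) ^ 3) ^ 3 * h3 -
      algebraMap ℚ (RatAlg O) ((b : ℚ) ^ 3) ^ 2 * coord τ e₃ d * h0
  have c2 := h2'
  rw [pow_two, coord_mul hsq, smul_coord, h.coord_inj] at c2
  have c3 := h3'
  rw [pow_succ, h2', smul_coord, coord_mul hsq, smul_coord, h.coord_inj] at c3
  have d1 : e₁ ^ 2 = b ^ 2 * (b * e₂ + w) := by
    have : (e₁ : ℚ) ^ 2 = b ^ 2 * (b * e₂ + w) := by linear_combination c2.1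
    exact_mod_cast this
  obtain ⟨e', rfl⟩ : b ∣ e₁ := (Int.pow_dvd_pow_iff two_ne_zero).1 (Dvd.intro _ d1.symm)
  have d2 : e' ^ 2 = b * e₂ + w := by
    apply mul_left_cancel₀ (pow_ne_zero 2 hb'); rw [← d1]; ring
  have d3 : 2 * e' + t = b * c := by
    have : (2 * e' + t : ℚ) = b * c := by
      apply mul_left_cancel₀ (pow_ne_zero 2 hb)
      have := c2.2
      push_cast at this
      linear_combination this
    exact_mod_cast this
  have d4 : e₂ + b * c ^ 2 - c * e' = b * (b * d) := by
    have : (e₂ + b * c ^ 2 - c * e' : ℚ) = b * (b * d) := by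
      apply mul_left_cancel₀ (pow_ne_zero 4 hb)
      have h4 := c3.2
      have d3' : (2 * e' + t : ℚ) = b * c := by exact_mod_cast d3
      push_cast at h4
      linear_combination h4 - (b : ℚ) ^ 4 * c * d3'
    exact_mod_cast this
  refine ⟨hb', e' + τ, orientation_add_int π hτ e', ?_, ?_⟩
  · have e1 : (b ^ 2 * (c ^ 2 - b * d) : ℤ) = -(b * e₂) + b * c * e' := by
      linear_combination b * d4
    have e2 : (b * e₂ : ℤ) = e' ^ 2 - w := by linarith
    have e3 : t = b * c - 2 * e' := by linarith
    rw [e1, e2]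
    rw [e3] at hsq
    push_cast at hsq ⊢
    linear_combination hsq
  · obtain ⟨u, hu⟩ := hα_unit
    have hbu : IsUnit (algebraMap ℚ (RatAlg O) (b : ℚ)) := (isUnit_iff_ne_zero.2 hb).map _
    have hbb : algebraMap ℚ (RatAlg O) (b : ℚ)⁻¹ * algebraMap ℚ (RatAlg O) (b : ℚ) = 1 := by
      rw [← map_mul, inv_mul_cancel₀ hb, map_one]
    obtain ⟨z, hz⟩ := hbu
    have hzi : ((z⁻¹ : (RatAlg O)ˣ) : RatAlg O) = algebraMap ℚ (RatAlg O) (b : ℚ)⁻¹ := by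
      rw [← mul_one ((z⁻¹ : (RatAlg O)ˣ) : RatAlg O), ← hbb, ← hz]
      rw [mul_comm (algebraMap ℚ (RatAlg O) (b : ℚ)⁻¹), Units.inv_mul_cancel_left]
    refine ⟨u * z⁻¹, ?_, ?_⟩
    · rw [hI]
      congr 2
      · rw [Units.val_mul, hu, hzi]
        simp only [coord, map_zero, zero_mul, add_zero]
        linear_combination (-α) * hbb
      · congr 1
        apply (z.isUnit.pow 3).mul_left_cancel
        rw [Units.val_mul, hu, hzi, hz, ← map_pow, hβα]
        simp only [coord, map_zero, zero_add, map_add, map_pow, map_intCast] at hbb ⊢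
        push_cast at hbb ⊢
        linear_combination (-α * b * (e' + algebraMap O (RatAlg O) τ) *
          (algebraMap ℚ (RatAlg O) (b : ℚ)⁻¹ * b + 1)) * hbb
    · ext
      have h5 : α ^ 3 = T.δ * z ^ 3 := by rw [h0, hz, map_pow]
      rw [mul_pow, Units.val_mul, Units.val_pow_eq_pow_val, hu, h5, inv_pow, mul_assoc,
        ← Units.val_pow_eq_pow_val, Units.mul_inv, mul_one]

theorem ringDisc_eq_disc [IsQuadraticRing O] {π : Orientation O} {f : CubicForm} (ha : f.a = 0)
    {θ : O} (hθ : π (Submodule.Quotient.mk θ) = 1)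
    (h : θ ^ 2 = ((f.b * f.c : ℤ) : O) * θ - ((f.b ^ 2 * (f.c ^ 2 - f.b * f.d) : ℤ) : O)) :
    ringDisc O = f.disc := by
  rw [(isGen_of_orientation π hθ).ringDisc_eq h, f.disc_of_a_eq_zero ha]; ring

/-- The form determines the class of the triple. -/
theorem Corresponds.triple_equivalent [IsQuadraticRing O] (hD : ringDisc O ≠ 0) {π : Orientation O}
    {T T' : Triple O} {f : CubicForm} (hf : T.Corresponds π f) (hf' : T'.Corresponds π f)
    (ha : f.a = 0) : T.Equivalent T' := by
  obtain ⟨hb, θ, hθ, hsq, κ, hI, hδ⟩ := hf.normalForm hD ha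
  obtain ⟨-, θ', hθ', hsq', κ', hI', hδ'⟩ := hf'.normalForm hD ha
  obtain ⟨z, rfl⟩ := IsGen.orientation_eq π hθ hθ'
  have h := isGen_of_orientation π hθ
  have hz : z = 0 := by
    have := h.eq_zero (z ^ 2 - f.b * f.c * z) (2 * z) (by
      push_cast at hsq hsq' ⊢; linear_combination hsq' - hsq)
    omega
  subst hz
  rw [Int.cast_zero, zero_add] at hI'
  refine ⟨κ' * κ⁻¹, ?_, ?_⟩
  · have := toAddSubgroup_span_singleton_mul ((κ' * κ⁻¹ : (RatAlg O)ˣ) : RatAlg O) T.I hI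
    rw [← mul_assoc, ← mul_assoc, ← Units.val_mul, inv_mul_cancel_right, ← hI'] at this
    exact (Submodule.toAddSubgroup_injective this).symm
  · rw [hδ, hδ', mul_pow, inv_pow, inv_mul_cancel_right]

/-- For a projective triple the coefficients `b` and `c` are coprime: if `p` divides both, then
`θ / p` multiplies `I` into itself, hence lies in `O`. -/
theorem Corresponds.isCoprime [IsQuadraticRing O] (hD : ringDisc O ≠ 0) {π : Orientation O}
    {T : Triple O} {f : CubicForm} (hf : T.Corresponds π f) (ha : f.a = 0) (hT : T.IsProjective) :
    IsCoprime f.b f.c := by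
  obtain ⟨hb, θ, hθ, hsq, κ, hI, hδ⟩ := hf.normalForm hD ha
  have h := isGen_of_orientation π hθ
  obtain ⟨a, b, c, d⟩ := f
  simp only at hb hsq hI ⊢
  rw [Int.isCoprime_iff_gcd_eq_one]
  have hg : (0 : ℤ) < Int.gcd b c := by exact_mod_cast Int.gcd_pos_of_ne_zero_left c hb
  obtain ⟨b', hb'⟩ := Int.gcd_dvd_left b c
  obtain ⟨c', hc'⟩ := Int.gcd_dvd_right b c
  suffices hg1 : (Int.gcd b c : ℤ) = 1 by exact_mod_cast hg1
  generalize (Int.gcd b c : ℤ) = g at *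
  have hgq : (g : ℚ) ≠ 0 := by exact_mod_cast hg.ne'
  have hbq : (b : ℚ) ≠ 0 := by exact_mod_cast hb
  have hb'q : (b : ℚ) = g * b' := by exact_mod_cast hb'
  have hb'0 : (b' : ℚ) ≠ 0 := by intro h0; rw [h0, mul_zero] at hb'q; exact hbq hb'q
  have hc'q : (c : ℚ) = g * c' := by exact_mod_cast hc'
  set ω : RatAlg O := coord θ 0 (g : ℚ)⁻¹ with hω
  have hmem : ∀ x, x ∈ T.I ↔ x ∈ AddSubgroup.closure
      {(κ : RatAlg O) * coord θ b 0, κ * coord θ 0 (b : ℚ)⁻¹} := fun x => by rw [← hI]; rfl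
  have hω1 : ω * (κ * coord θ b 0) ∈ T.I := by
    rw [hmem, AddSubgroup.mem_closure_pair]
    refine ⟨0, b * b', ?_⟩
    have : ω * coord θ b 0 = algebraMap ℚ _ ((b * b' : ℤ) : ℚ) * coord θ 0 (b : ℚ)⁻¹ := by
      rw [hω, coord_mul hsq, smul_coord, h.coord_inj]
      push_cast
      refine ⟨by ring, ?_⟩
      rw [hb'q]; field_simp; ring
    rw [zsmul_eq_mul, zsmul_eq_mul, mul_left_comm ω, this]
    rw [map_intCast]; push_cast; ring
  have hω2 : ω * (κ * coord θ 0 (b : ℚ)⁻¹) ∈ T.I := by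
    rw [hmem, AddSubgroup.mem_closure_pair]
    refine ⟨-(g * c' ^ 2 - b' * d), b' * c, ?_⟩
    have : ω * coord θ 0 (b : ℚ)⁻¹ =
        algebraMap ℚ _ ((-(g * c' ^ 2 - b' * d) : ℤ) : ℚ) * coord θ b 0 +
        algebraMap ℚ _ ((b' * c : ℤ) : ℚ) * coord θ 0 (b : ℚ)⁻¹ := by
      rw [hω, coord_mul hsq, smul_coord, smul_coord, coord_add, h.coord_inj]
      push_cast
      rw [hc'q, hb'q]
      constructor <;> field_simp <;> ring
    rw [zsmul_eq_mul, zsmul_eq_mul, mul_left_comm ω, this]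
    rw [map_intCast, map_intCast]; push_cast; ring
  have hωI : ∀ x ∈ T.I, ω * x ∈ T.I := by
    intro x hx
    rw [hmem, AddSubgroup.mem_closure_pair] at hx
    obtain ⟨m, n, rfl⟩ := hx
    have : ω * (m • ((κ : RatAlg O) * coord θ b 0) + n • (κ * coord θ 0 (b : ℚ)⁻¹)) =
      m • (ω * ((κ : RatAlg O) * coord θ b 0)) + n • (ω * (κ * coord θ 0 (b : ℚ)⁻¹)) := by
      simp only [zsmul_eq_mul]; ring
    rw [this]
    exact add_mem (T.I.toAddSubgroup.zsmul_mem hω1 m) (T.I.toAddSubgroup.zsmul_mem hω2 n)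
  obtain ⟨J, hJ⟩ := hT.exists_right_inv
  have hω_mem : ω ∈ (1 : Submodule O (RatAlg O)) := by
    have h1 : (1 : RatAlg O) ∈ T.I * J := by rw [hJ]; exact Submodule.mem_one.2 ⟨1, map_one _⟩
    have h2 : ∀ y ∈ T.I * J, ω * y ∈ T.I * J := by
      intro y hy
      induction hy using Submodule.mul_induction_on' with
      | mem_mul_mem m hm n hn => rw [← mul_assoc]; exact Submodule.mul_mem_mul (hωI m hm) hn
      | add x _ y _ hx hy => rw [mul_add]; exact add_mem hx hy
    have h3 := h2 1 h1
    rwa [mul_one, hJ] at h3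
  obtain ⟨y, hy⟩ := Submodule.mem_one.1 hω_mem
  obtain ⟨m, n, rfl⟩ := h.exists_eq y
  rw [algebraMap_eq_coord, hω, h.coord_inj] at hy
  have : (n * g : ℤ) = 1 := by
    have : (n : ℚ) * g = 1 := by rw [hy.2]; exact inv_mul_cancel₀ hgq
    exact_mod_cast this
  have := Int.eq_one_or_neg_one_of_mul_eq_one' this
  omega

end Triple
end

section
variable {O : Type*} [CommRing O]

/-! ### The triple of a reducible form -/

section
variable {θ : O} {f : CubicForm}

theorem coord_theta_sq (hsq : θ ^ 2 = ((f.b * f.c : ℤ) : O) * θ -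
    ((f.b ^ 2 * (f.c ^ 2 - f.b * f.d) : ℤ) : O)) (hb : f.b ≠ 0) :
    coord θ 0 (f.b : ℚ)⁻¹ * coord θ 0 (f.b : ℚ)⁻¹ =
      (f.c : RatAlg O) * coord θ 0 (f.b : ℚ)⁻¹ - (f.c ^ 2 - f.b * f.d) := by
  have hb' : (f.b : ℚ) ≠ 0 := by exact_mod_cast hb
  have e1 : (f.c : RatAlg O) = algebraMap ℚ _ (f.c : ℚ) := by simp
  have e2 : (f.c ^ 2 - f.b * f.d : RatAlg O) =
      algebraMap ℚ _ ((f.c ^ 2 - f.b * f.d : ℤ) : ℚ) := by rw [map_intCast]; push_cast; ring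
  rw [eq_sub_iff_add_eq, e2, e1, coord_mul hsq, smul_coord, algebraMap_rat_eq_coord θ, coord_add]
  congr 1 <;> push_cast <;> field_simp <;> ring

/-- The ideal `ℤ b + ℤ θ / b` attached to a form `3 b x² y + 3 c x y² + d y³`. -/
noncomputable def normalIdeal (θ : O) (b : ℤ) : Submodule O (RatAlg O) :=
  Submodule.span O {coord θ b 0, coord θ 0 (b : ℚ)⁻¹}

theorem normalIdeal_toAddSubgroup (hθ : IsGen θ) (hsq : θ ^ 2 = ((f.b * f.c : ℤ) : O) * θ -
    ((f.b ^ 2 * (f.c ^ 2 - f.b * f.d) : ℤ) : O)) (hb : f.b ≠ 0) :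
    (normalIdeal θ f.b).toAddSubgroup =
      AddSubgroup.closure {coord θ f.b 0, coord θ 0 (f.b : ℚ)⁻¹} := by
  have hb' : (f.b : ℚ) ≠ 0 := by exact_mod_cast hb
  set A := AddSubgroup.closure {coord θ f.b 0, coord θ 0 (f.b : ℚ)⁻¹} with hA
  have hαA : coord θ f.b 0 ∈ A := AddSubgroup.subset_closure (by simp)
  have hβA : coord θ 0 (f.b : ℚ)⁻¹ ∈ A := AddSubgroup.subset_closure (by simp)
  have h1 : algebraMap O (RatAlg O) θ * coord θ f.b 0 ∈ A := by
    have : algebraMap O (RatAlg O) θ * coord θ f.b 0 = (f.b ^ 2) • coord θ 0 (f.b : ℚ)⁻¹ := by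
      have e : algebraMap O (RatAlg O) θ = coord θ 0 1 := by simp [coord]
      rw [e, coord_mul hsq, zsmul_eq_mul, ← map_intCast (algebraMap ℚ (RatAlg O)), smul_coord]
      congr 1 <;> push_cast <;> field_simp <;> ring
    rw [this]; exact A.zsmul_mem hβA _
  have h2 : algebraMap O (RatAlg O) θ * coord θ 0 (f.b : ℚ)⁻¹ ∈ A := by
    have : algebraMap O (RatAlg O) θ * coord θ 0 (f.b : ℚ)⁻¹ =
        (f.b * f.c) • coord θ 0 (f.b : ℚ)⁻¹ + (-(f.c ^ 2 - f.b * f.d)) • coord θ f.b 0 := by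
      have e : algebraMap O (RatAlg O) θ = coord θ 0 1 := by simp [coord]
      rw [e, coord_mul hsq, zsmul_eq_mul, zsmul_eq_mul, ← map_intCast (algebraMap ℚ (RatAlg O)),
        ← map_intCast (algebraMap ℚ (RatAlg O)), smul_coord, smul_coord, coord_add]
      congr 1 <;> push_cast <;> field_simp <;> ring
    rw [this]; exact add_mem (A.zsmul_mem hβA _) (A.zsmul_mem hαA _)
  have hθA : ∀ x ∈ A, algebraMap O (RatAlg O) θ * x ∈ A := by
    intro x hx
    rw [hA, AddSubgroup.mem_closure_pair] at hx
    obtain ⟨m, n, rfl⟩ := hx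
    rw [mul_add, mul_smul_comm, mul_smul_comm]
    exact add_mem (A.zsmul_mem h1 _) (A.zsmul_mem h2 _)
  let S : Submodule O (RatAlg O) :=
    { A with
      smul_mem' := fun y x hx => by
        obtain ⟨m, k, rfl⟩ := hθ.exists_eq y
        have : ((m : O) + k * θ) • x = m • x + k • (algebraMap O (RatAlg O) θ * x) := by
          rw [Algebra.smul_def]; simp only [map_add, map_mul, map_intCast, zsmul_eq_mul]; ring
        rw [this]
        exact add_mem (A.zsmul_mem hx _) (A.zsmul_mem (hθA x hx) _) }
  apply le_antisymm
  · have : normalIdeal θ f.b ≤ S := by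
      rw [normalIdeal, Submodule.span_le]
      rintro x (rfl | rfl)
      · exact hαA
      · exact hβA
    exact this
  · rw [AddSubgroup.closure_le]
    exact Submodule.subset_span

/-- The triple `(O, ℤ b + ℤ θ / b, 1)` attached to a form `3 b x² y + 3 c x y² + d y³`. -/
noncomputable def normalTriple (hθ : IsGen θ) (hsq : θ ^ 2 = ((f.b * f.c : ℤ) : O) * θ -
    ((f.b ^ 2 * (f.c ^ 2 - f.b * f.d) : ℤ) : O)) (hb : f.b ≠ 0) : Triple O where
  I := normalIdeal θ f.b
  δ := 1
  fg := Submodule.fg_span (by simp)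
  full := by
    have hb' : (f.b : ℚ) ≠ 0 := by exact_mod_cast hb
    rw [eq_top_iff]
    rintro x -
    obtain ⟨p, q, rfl⟩ := hθ.coord_surj x
    have e : coord θ p q = (p / f.b) • coord θ f.b 0 + (q * f.b) • coord θ 0 (f.b : ℚ)⁻¹ := by
      rw [Algebra.smul_def, Algebra.smul_def, smul_coord, smul_coord, coord_add]
      congr 1 <;> field_simp <;> ring
    rw [e]
    exact add_mem (Submodule.smul_mem _ _ (Submodule.subset_span (Submodule.subset_span (by simp))))
      (Submodule.smul_mem _ _ (Submodule.subset_span (Submodule.subset_span (by simp))))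
  cube_le := by
    have hbb : algebraMap ℚ (RatAlg O) (f.b : ℚ) * coord θ 0 (f.b : ℚ)⁻¹ = algebraMap O _ θ := by
      have hb' : (f.b : ℚ) ≠ 0 := by exact_mod_cast hb
      rw [smul_coord]; simp [coord, hb']
    have hββ := coord_theta_sq hsq hb
    have hα : coord θ (f.b : ℚ) 0 = algebraMap ℚ (RatAlg O) (f.b : ℚ) := by simp [coord]
    rw [normalIdeal, hα]
    set β := coord θ 0 (f.b : ℚ)⁻¹
    simp only [map_intCast] at hbb ⊢
    have c3 : ((f.b : RatAlg O)) * (f.b * f.b) ∈ (1 : Submodule O (RatAlg O)) :=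
      Submodule.mem_one.2 ⟨(f.b : O) * (f.b * f.b), by simp⟩
    have c2 : (f.b : RatAlg O) * (f.b * β) ∈ (1 : Submodule O (RatAlg O)) :=
      Submodule.mem_one.2 ⟨f.b * θ, by simp [hbb]⟩
    have c1 : (f.b : RatAlg O) * (β * β) ∈ (1 : Submodule O (RatAlg O)) := by
      refine Submodule.mem_one.2 ⟨f.c * θ - f.b * (f.c ^ 2 - f.b * f.d), ?_⟩
      simp only [hββ, map_sub, map_mul, map_intCast, map_pow, ← hbb]; ring
    have c0 : β * (β * β) ∈ (1 : Submodule O (RatAlg O)) := by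
      refine Submodule.mem_one.2 ⟨f.d * θ - f.c * (f.c ^ 2 - f.b * f.d), ?_⟩
      simp only [map_sub, map_mul, map_intCast, map_pow, ← hbb]
      linear_combination (-β - f.c) * hββ
    rw [Units.val_one, ← Submodule.one_eq_span, pow_succ, pow_two, Submodule.span_mul_span,
      Submodule.span_mul_span, Submodule.span_le]
    rintro _ ⟨_, ⟨x, hx, y, hy, rfl⟩, z, hz, rfl⟩
    simp only [SetLike.mem_coe]
    rcases hx with rfl | rfl <;> rcases hy with rfl | rfl <;> rcases hz with rfl | rfl
    · convert c3 using 1; ring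
    · convert c2 using 1; ring
    · convert c2 using 1; ring
    · convert c1 using 1; ring
    · convert c2 using 1; ring
    · convert c1 using 1; ring
    · convert c1 using 1; ring
    · convert c0 using 1; ring
  norm_eq := by
    have hb' : (f.b : ℚ) ≠ 0 := by exact_mod_cast hb
    rw [hθ.idealNorm_eq _ (normalIdeal_toAddSubgroup hθ hsq hb)] <;> simp [hb']

theorem normalTriple_corresponds {π : Orientation O} (hπ : π (Submodule.Quotient.mk θ) = 1)
    (hθ : IsGen θ) (hsq : θ ^ 2 = ((f.b * f.c : ℤ) : O) * θ -
    ((f.b ^ 2 * (f.c ^ 2 - f.b * f.d) : ℤ) : O)) (ha : f.a = 0) (hb : f.b ≠ 0) :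
    (normalTriple hθ hsq hb).Corresponds π f := by
  have hb' : (f.b : ℚ) ≠ 0 := by exact_mod_cast hb
  refine ⟨θ, hπ, _, _, normalIdeal_toAddSubgroup hθ hsq hb, ⟨_, _, _, _, rfl, rfl, by simp [hb']⟩,
    f.b ^ 3, 0, -(f.b * (f.c ^ 2 - f.b * f.d)), -(f.c * (f.c ^ 2 - f.b * f.d)), ?_⟩
  have hbb : algebraMap ℚ (RatAlg O) (f.b : ℚ) * coord θ 0 (f.b : ℚ)⁻¹ = algebraMap O _ θ := by
    rw [smul_coord]; simp [coord, hb']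
  have hββ := coord_theta_sq hsq hb
  have hα : coord θ (f.b : ℚ) 0 = algebraMap ℚ (RatAlg O) (f.b : ℚ) := by simp [coord]
  have hδ : (((normalTriple hθ hsq hb).δ : (RatAlg O)ˣ) : RatAlg O) = 1 := rfl
  rw [hα, hδ, ha]
  set β := coord θ 0 (f.b : ℚ)⁻¹
  simp only [map_intCast] at hbb ⊢
  simp only [map_add, map_mul, map_intCast, ← hbb, Int.cast_neg, map_neg, map_sub, map_pow,
    Int.cast_zero, Int.cast_mul, Int.cast_sub, Int.cast_pow]
  refine ⟨by simp, by simp; ring, ?_, ?_⟩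
  · linear_combination (f.b : RatAlg O) * hββ
  · linear_combination (β + f.c) * hββ

open scoped Pointwise in
/-- If `b` and `c` are coprime, then `ℤ b + ℤ θ / b` is invertible; up to `O` its inverse is the
conjugate ideal. -/
theorem normalTriple_isProjective (hθ : IsGen θ) (hsq : θ ^ 2 = ((f.b * f.c : ℤ) : O) * θ -
    ((f.b ^ 2 * (f.c ^ 2 - f.b * f.d) : ℤ) : O)) (hb : f.b ≠ 0) (hc : IsCoprime f.b f.c) :
    (normalTriple hθ hsq hb).IsProjective := by
  have hb' : (f.b : ℚ) ≠ 0 := by exact_mod_cast hb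
  change IsUnit (normalIdeal θ f.b)
  have hbb : algebraMap ℚ (RatAlg O) (f.b : ℚ) * coord θ 0 (f.b : ℚ)⁻¹ = algebraMap O _ θ := by
    rw [smul_coord]; simp [coord, hb']
  have hββ := coord_theta_sq hsq hb
  have hα : coord θ (f.b : ℚ) 0 = algebraMap ℚ (RatAlg O) (f.b : ℚ) := by simp [coord]
  rw [normalIdeal, hα]
  set β := coord θ 0 (f.b : ℚ)⁻¹
  simp only [map_intCast] at hbb ⊢
  refine IsUnit.of_mul_eq_one (Submodule.span O ({(f.b : RatAlg O), f.c - β} : Set (RatAlg O))) ?_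
  rw [Submodule.span_mul_span]
  apply le_antisymm
  · rw [Submodule.span_le]
    rintro _ ⟨x, hx, y, hy, rfl⟩
    simp only [SetLike.mem_coe]
    rcases hx with rfl | rfl <;> rcases hy with rfl | rfl
    · exact Submodule.mem_one.2 ⟨(f.b : O) * f.b, by simp⟩
    · exact Submodule.mem_one.2 ⟨(f.b : O) * f.c - θ, by simp [← hbb]; ring⟩
    · exact Submodule.mem_one.2 ⟨θ, by simp [← hbb]; ring⟩
    · exact Submodule.mem_one.2 ⟨f.c ^ 2 - f.b * f.d, by simp; linear_combination hββ⟩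
  · set M := Submodule.span O 
      (({(f.b : RatAlg O), β} : Set (RatAlg O)) * ({(f.b : RatAlg O), f.c - β} : Set (RatAlg O)))
    have m1 : (f.b : RatAlg O) * f.b ∈ M :=
      Submodule.subset_span (Set.mul_mem_mul (by simp) (by simp))
    have m2 : (f.b : RatAlg O) * (f.c - β) ∈ M :=
      Submodule.subset_span (Set.mul_mem_mul (by simp) (by simp))
    have m3 : β * f.b ∈ M :=
      Submodule.subset_span (Set.mul_mem_mul (by simp) (by simp))
    have m4 : β * (f.c - β) ∈ M :=
      Submodule.subset_span (Set.mul_mem_mul (by simp) (by simp))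
    -- `b`, `b c` and `c ^ 2 - b d` generate the unit ideal
    obtain ⟨u, v, huv⟩ := hc
    have huv' : (u * f.b + v * f.c : RatAlg O) = 1 := by
      exact_mod_cast congrArg (Int.cast : ℤ → RatAlg O) huv
    have hbM : (f.b : RatAlg O) ∈ M := by
      have e : (f.b : RatAlg O) = u • ((f.b : RatAlg O) * f.b) +
          v • ((f.b : RatAlg O) * (f.c - β) + β * f.b) := by
        simp only [zsmul_eq_mul]; linear_combination -(f.b : RatAlg O) * huv'
      rw [e]
      exact add_mem (zsmul_mem m1 _) (zsmul_mem (add_mem m2 m3) _)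
    have h1M : (1 : RatAlg O) ∈ M := by
      have e : (1 : RatAlg O) = (v ^ 2) • (β * (f.c - β)) +
          (u ^ 2 * f.b + 2 * u * v * f.c + v ^ 2 * f.d) • (f.b : RatAlg O) := by
        simp only [zsmul_eq_mul]; push_cast
        linear_combination (-1 - u * f.b - v * f.c) * huv' + v ^ 2 * hββ
      rw [e]
      exact add_mem (zsmul_mem m4 _) (zsmul_mem hbM _)
    rw [Submodule.one_le]
    exact h1M

end

/-- Over a quadratic ring of discriminant `disc f` there is the generator `θ` that the normal form
requires. -/
theorem exists_theta {π : Orientation O} [IsQuadraticRing O] {f : CubicForm} (ha : f.a = 0)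
    (hD : ringDisc O = f.disc) : ∃ θ : O, π (Submodule.Quotient.mk θ) = 1 ∧
      θ ^ 2 = ((f.b * f.c : ℤ) : O) * θ - ((f.b ^ 2 * (f.c ^ 2 - f.b * f.d) : ℤ) : O) := by
  obtain ⟨x, hx⟩ := π.surjective 1
  obtain ⟨τ, rfl⟩ := Submodule.Quotient.mk_surjective _ x
  have h := isGen_of_orientation π hx
  obtain ⟨t, n, hsq⟩ := h.exists_sq
  rw [h.ringDisc_eq hsq, CubicForm.disc_of_a_eq_zero ha] at hD
  have hpar : ∃ e, f.b * f.c = t + 2 * e := by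
    have h1 : (f.b * f.c - t) * (f.b * f.c + t) =
        4 * (f.b ^ 2 * (f.c ^ 2 - f.b * f.d) - n) := by linear_combination -hD
    have h2 : (f.b * f.c - t) % 2 = 0 := by
      have h3 : ((f.b * f.c - t) * (f.b * f.c - t + 2 * t)) % 2 = 0 := by
        rw [show f.b * f.c - t + 2 * t = f.b * f.c + t by ring, h1]; omega
      rcases Int.emod_two_eq_zero_or_one (f.b * f.c - t) with h4 | h4
      · exact h4
      · rw [Int.mul_emod, Int.add_mul_emod_self_left, h4] at h3; simp at h3
    exact ⟨(f.b * f.c - t) / 2, by omega⟩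
  obtain ⟨e, he⟩ := hpar
  refine ⟨e + τ, orientation_add_int π hx e, ?_⟩
  have e1 : f.b ^ 2 * (f.c ^ 2 - f.b * f.d) = n + t * e + e ^ 2 := by
    have : t = f.b * f.c - 2 * e := by linarith
    rw [this] at hD ⊢
    linarith
  rw [e1, he]; push_cast; linear_combination hsq

/-! ### Bases of ideals -/

theorem exists_int_mul_mem_range {τ : O} (h : IsGen τ) {I : Submodule O (RatAlg O)} (hI : I.FG) :
    ∃ N : ℕ, N ≠ 0 ∧ ∀ x ∈ I, ∃ y : O, (N : RatAlg O) * x = algebraMap O _ y := by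
  induction I, hI using Submodule.fg_induction with
  | singleton x =>
    obtain ⟨p, q, rfl⟩ := h.coord_surj x
    refine ⟨p.den * q.den, by positivity, fun z hz => ?_⟩
    obtain ⟨a, rfl⟩ := Submodule.mem_span_singleton.1 hz
    refine ⟨a * ((p.num * q.den : ℤ) + (q.num * p.den : ℤ) * τ), ?_⟩
    rw [map_mul, algebraMap_eq_coord, Algebra.smul_def, mul_left_comm]
    congr 1
    rw [← map_natCast (algebraMap ℚ (RatAlg O)), smul_coord]
    congr 1
    · push_cast; linear_combination (q.den : ℚ) * Rat.mul_den_eq_num p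
    · push_cast; linear_combination (p.den : ℚ) * Rat.mul_den_eq_num q
  | sup M₁ M₂ _ _ h₁ h₂ =>
    obtain ⟨N, hN, hN'⟩ := h₁
    obtain ⟨N₂, hN₂, hN₂'⟩ := h₂
    refine ⟨N * N₂, mul_ne_zero hN hN₂, fun x hx => ?_⟩
    obtain ⟨y, hy, z, hz, rfl⟩ := Submodule.mem_sup.1 hx
    obtain ⟨u, hu⟩ := hN' y hy
    obtain ⟨v, hv⟩ := hN₂' z hz
    refine ⟨N₂ * u + N * v, ?_⟩
    simp only [map_add, map_mul, map_natCast, ← hu, ← hv]; push_cast; ring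

theorem exists_zmultiples_of_bounded (S : AddSubgroup ℚ) {N : ℕ} (hN : N ≠ 0)
    (h : ∀ x ∈ S, ∃ m : ℤ, (N : ℚ) * x = m) : ∃ g ∈ S, 0 ≤ g ∧ ∀ x ∈ S, ∃ k : ℤ, x = k * g := by
  have hN' : (N : ℚ) ≠ 0 := by exact_mod_cast hN
  let φ : ℤ →+ ℚ := (AddMonoidHom.mulRight (N : ℚ)⁻¹).comp (Int.castAddHom ℚ)
  have hφ : ∀ m : ℤ, φ m = m * (N : ℚ)⁻¹ := fun m => rfl
  obtain ⟨a, ha⟩ := Int.subgroup_cyclic (S.comap φ)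
  have haS : φ a ∈ S := by
    have : a ∈ S.comap φ := by rw [ha]; exact AddSubgroup.subset_closure rfl
    exact this
  have key : ∀ x ∈ S, ∃ k : ℤ, x = k * φ a := by
    intro x hx
    obtain ⟨m, hm⟩ := h x hx
    have hxm : x = φ m := by rw [hφ, ← hm]; field_simp
    have : m ∈ S.comap φ := by change φ m ∈ S; rwa [← hxm]
    rw [ha, AddSubgroup.mem_closure_singleton] at this
    obtain ⟨k, rfl⟩ := this
    exact ⟨k, by rw [hxm, map_zsmul, zsmul_eq_mul]⟩
  rcases le_total 0 (φ a) with h0 | h0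
  · exact ⟨φ a, haS, h0, key⟩
  · refine ⟨-φ a, neg_mem haS, by linarith, fun x hx => ?_⟩
    obtain ⟨k, rfl⟩ := key x hx
    exact ⟨-k, by push_cast; ring⟩

/-- A full-rank ideal has a positively oriented `ℤ`-basis whose first vector is rational. -/
theorem exists_basis_rational {τ : O} (h : IsGen τ) {I : Submodule O (RatAlg O)} (hI : I.FG)
    (hfull : Submodule.span ℚ (I : Set (RatAlg O)) = ⊤) : ∃ p r s : ℚ, 0 < p ∧ 0 < s ∧
      I.toAddSubgroup = AddSubgroup.closure {coord τ p 0, coord τ r s} := by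
  obtain ⟨N, hN, hN'⟩ := exists_int_mul_mem_range h hI
  have hcoef : ∀ p q, coord τ p q ∈ I → (∃ m : ℤ, (N : ℚ) * p = m) ∧ ∃ m : ℤ, (N : ℚ) * q = m := by
    intro p q hpq
    obtain ⟨y, hy⟩ := hN' _ hpq
    obtain ⟨m, k, rfl⟩ := h.exists_eq y
    rw [algebraMap_eq_coord, ← map_natCast (algebraMap ℚ (RatAlg O)), smul_coord, h.coord_inj] at hy
    exact ⟨⟨m, hy.1⟩, ⟨k, hy.2⟩⟩
  have hneg : ∀ p q, -coord τ p q = coord τ (-p) (-q) := by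
    intro p q; simp only [coord, map_neg]; ring
  let P : AddSubgroup ℚ :=
    { carrier := {p | coord τ p 0 ∈ I}
      zero_mem' := by
        change coord τ 0 0 ∈ I
        rw [← zero_eq_coord]; exact I.zero_mem
      add_mem' := fun {a b} ha hb => by
        have := I.add_mem ha hb
        rw [coord_add, add_zero] at this; exact this
      neg_mem' := fun {a} ha => by
        have := I.neg_mem ha
        rw [hneg, neg_zero] at this; exact this }
  let Q : AddSubgroup ℚ :=
    { carrier := {q | ∃ p, coord τ p q ∈ I}
      zero_mem' := ⟨0, by rw [← zero_eq_coord]; exact I.zero_mem⟩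
      add_mem' := fun {a b} ha hb => by
        obtain ⟨p, hp⟩ := ha
        obtain ⟨p', hp'⟩ := hb
        exact ⟨p + p', by rw [← coord_add]; exact I.add_mem hp hp'⟩
      neg_mem' := fun {a} ha => by
        obtain ⟨p, hp⟩ := ha
        exact ⟨-p, by rw [← hneg]; exact I.neg_mem hp⟩ }
  obtain ⟨p, hpP, hp0, hp⟩ := exists_zmultiples_of_bounded P hN fun x hx => (hcoef x 0 hx).1
  obtain ⟨s, ⟨r, hrs⟩, hs0, hs⟩ := exists_zmultiples_of_bounded Q hN
    fun x ⟨y, hy⟩ => (hcoef y x hy).2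
  have hpI : coord τ p 0 ∈ I := hpP
  have hcl : I.toAddSubgroup = AddSubgroup.closure {coord τ p 0, coord τ r s} := by
    apply le_antisymm
    · intro x hx
      obtain ⟨u, v, rfl⟩ := h.coord_surj x
      obtain ⟨k, rfl⟩ := hs v ⟨u, hx⟩
      have : coord τ (u - k * r) 0 ∈ I := by
        have e : coord τ (u - k * r) 0 = coord τ u (k * s) - k • coord τ r s := by
          simp only [coord, map_sub, map_mul, map_intCast, zsmul_eq_mul, map_zero]; ring
        rw [e]; exact I.sub_mem hx (zsmul_mem hrs k)
      obtain ⟨m, hm⟩ := hp _ this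
      rw [AddSubgroup.mem_closure_pair]
      refine ⟨m, k, ?_⟩
      have hu : u = m * p + k * r := by linarith
      rw [hu]
      simp only [coord, map_add, map_mul, map_intCast, zsmul_eq_mul, map_zero]; ring
    · rw [AddSubgroup.closure_le]
      rintro x (rfl | rfl)
      · exact hpI
      · exact hrs
  have hspan : ∀ x : RatAlg O, ∃ m k : ℚ, x = coord τ (m * p + k * r) (k * s) := by
    intro x
    have hx : x ∈ Submodule.span ℚ (I : Set (RatAlg O)) := by rw [hfull]; trivial
    induction hx using Submodule.span_induction with
    | mem x hx =>
      have : x ∈ I.toAddSubgroup := hx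
      rw [hcl, AddSubgroup.mem_closure_pair] at this
      obtain ⟨m, k, rfl⟩ := this
      refine ⟨m, k, ?_⟩
      simp only [coord, map_add, map_mul, map_intCast, zsmul_eq_mul, map_zero]; ring
    | zero => exact ⟨0, 0, by rw [zero_eq_coord τ]; simp⟩
    | add x y _ _ hx hy =>
      obtain ⟨m, k, rfl⟩ := hx
      obtain ⟨m', k', rfl⟩ := hy
      exact ⟨m + m', k + k', by rw [coord_add]; congr 1 <;> ring⟩
    | smul a x _ hx =>
      obtain ⟨m, k, rfl⟩ := hx
      exact ⟨a * m, a * k, by rw [Algebra.smul_def, smul_coord]; congr 1 <;> ring⟩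
  have hs' : s ≠ 0 := by
    rintro rfl
    obtain ⟨m, k, e⟩ := hspan (coord τ 0 1)
    rw [h.coord_inj] at e
    simp at e
  have hp' : p ≠ 0 := by
    rintro rfl
    obtain ⟨m, k, e⟩ := hspan (coord τ 1 0)
    rw [h.coord_inj] at e
    obtain ⟨e1, e2⟩ := e
    have : k = 0 := (mul_eq_zero.1 e2.symm).resolve_right hs'
    rw [this] at e1; simp at e1
  exact ⟨p, r, s, lt_of_le_of_ne hp0 hp'.symm, lt_of_le_of_ne hs0 hs'.symm, hcl⟩

theorem idealNorm_span_singleton_mul [IsQuadraticRing O] (κ : (RatAlg O)ˣ)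
    {I : Submodule O (RatAlg O)} (hI : I.FG)
    (hfull : Submodule.span ℚ (I : Set (RatAlg O)) = ⊤) :
    idealNorm (Submodule.span O {(κ : RatAlg O)} * I) =
      |Algebra.norm ℚ (κ : RatAlg O)| * idealNorm I := by
  obtain ⟨τ, h⟩ := exists_isGen O
  obtain ⟨t, n, hsq⟩ := h.exists_sq
  obtain ⟨p, r, s, hp, hs, hcl⟩ := exists_basis_rational h hI hfull
  obtain ⟨u, v, huv⟩ := h.coord_surj (κ : RatAlg O)
  have hN := h.norm_coord hsq u v
  rw [← huv] at hN
  have hN0 : Algebra.norm ℚ (κ : RatAlg O) ≠ 0 := (κ.isUnit.map (Algebra.norm ℚ)).ne_zero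
  have hcl' := Triple.toAddSubgroup_span_singleton_mul (κ : RatAlg O) I hcl
  rw [huv, coord_mul hsq, coord_mul hsq, ← huv] at hcl'
  have hdet : p * s - 0 * r ≠ 0 := by simp [hp.ne', hs.ne']
  have hdet' : (u * p - n * v * 0) * (u * s + v * r + t * v * s) -
      (u * 0 + v * p + t * v * 0) * (u * r - n * v * s) =
      Algebra.norm ℚ (κ : RatAlg O) * (p * s - 0 * r) := by rw [hN]; ring
  rw [h.idealNorm_eq _ hcl hdet, h.idealNorm_eq _ hcl' (by rw [hdet']; exact mul_ne_zero hN0 hdet),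
    hdet', abs_mul]

/-- The triple `(O, κ I, κ³ δ)`, for `κ` of positive norm. -/
noncomputable def Triple.scale [IsQuadraticRing O] (T : Triple O) (κ : (RatAlg O)ˣ)
    (hκ : 0 < Algebra.norm ℚ (κ : RatAlg O)) : Triple O where
  I := Submodule.span O {(κ : RatAlg O)} * T.I
  δ := κ ^ 3 * T.δ
  fg := (Submodule.fg_span_singleton _).mul T.fg
  full := by
    rw [eq_top_iff]
    rintro x -
    have hx : ((κ⁻¹ : (RatAlg O)ˣ) : RatAlg O) * x ∈ Submodule.span ℚ (T.I : Set (RatAlg O)) := by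
      rw [T.full]; trivial
    rw [← Units.mul_inv_cancel_left κ x]
    generalize ((κ⁻¹ : (RatAlg O)ˣ) : RatAlg O) * x = y at hx
    induction hx using Submodule.span_induction with
    | mem y hy =>
      exact Submodule.subset_span (Submodule.mul_mem_mul (Submodule.mem_span_singleton_self _) hy)
    | zero => rw [mul_zero]; exact Submodule.zero_mem _
    | add y z _ _ hy hz => rw [mul_add]; exact Submodule.add_mem _ hy hz
    | smul a y _ hy => rw [mul_smul_comm]; exact Submodule.smul_mem _ a hy
  cube_le := by
    rw [mul_pow, Submodule.span_pow, Set.singleton_pow, Units.val_mul, Units.val_pow_eq_pow_val,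
      ← Set.singleton_mul_singleton, ← Submodule.span_mul_span]
    exact mul_le_mul_right T.cube_le _
  norm_eq := by
    rw [idealNorm_span_singleton_mul κ T.fg T.full, mul_pow, T.norm_eq, Units.val_mul, map_mul,
      Units.val_pow_eq_pow_val, map_pow, abs_of_pos hκ]

/-- A triple with `δ = 1` corresponds to a form with a rational root: the first basis vector of `I`
can be chosen in `ℚ`, and then its cube is an integer. -/
theorem Triple.exists_corresponds_of_delta_eq_one [IsQuadraticRing O] (π : Orientation O)
    (T : Triple O) (hT : T.δ = 1) : ∃ f : CubicForm, f.a = 0 ∧ T.Corresponds π f := by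
  obtain ⟨x, hx⟩ := π.surjective 1
  obtain ⟨τ, rfl⟩ := Submodule.Quotient.mk_surjective _ x
  have h := isGen_of_orientation π hx
  obtain ⟨p, r, s, hp, hs, hI⟩ := exists_basis_rational h T.fg T.full
  have hα : coord τ p 0 ∈ T.I := by
    have : coord τ p 0 ∈ T.I.toAddSubgroup := by rw [hI]; exact AddSubgroup.subset_closure (by simp)
    exact this
  have hβ : coord τ r s ∈ T.I := by
    have : coord τ r s ∈ T.I.toAddSubgroup := by rw [hI]; exact AddSubgroup.subset_closure (by simp)
    exact this
  have key : ∀ x ∈ T.I, ∀ y ∈ T.I, ∀ z ∈ T.I, ∃ m k : ℤ,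
      x * y * z = (T.δ : RatAlg O) * algebraMap O _ (m + k * τ) := by
    intro x hx y hy z hz
    have h1 : x * y * z ∈ T.I ^ 3 := by
      rw [pow_succ, pow_two]
      exact Submodule.mul_mem_mul (Submodule.mul_mem_mul hx hy) hz
    obtain ⟨w, hw⟩ := Submodule.mem_span_singleton.1 (T.cube_le h1)
    obtain ⟨m, k, rfl⟩ := h.exists_eq w
    exact ⟨m, k, by rw [← hw, Algebra.smul_def, mul_comm]⟩
  obtain ⟨e₀, a, h0⟩ := key _ hα _ hα _ hα
  obtain ⟨e₁, b, h1⟩ := key _ hα _ hα _ hβ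
  obtain ⟨e₂, c, h2⟩ := key _ hα _ hβ _ hβ
  obtain ⟨e₃, d, h3⟩ := key _ hβ _ hβ _ hβ
  have ha : a = 0 := by
    rw [hT, Units.val_one, one_mul, algebraMap_eq_coord, ← algebraMap_rat_eq_coord, ← map_mul,
      ← map_mul, algebraMap_rat_eq_coord τ, h.coord_inj] at h0
    exact_mod_cast h0.2.symm
  refine ⟨⟨a, b, c, d⟩, ha, τ, hx, coord τ p 0, coord τ r s, hI,
    ⟨p, 0, r, s, rfl, rfl, by rw [zero_mul, sub_zero]; exact mul_pos hp hs⟩, e₀, e₁, e₂, e₃, ?_, ?_, ?_, ?_⟩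
  · rw [← h0]; ring
  · rw [← h1]; ring
  · rw [← h2]; ring
  · rw [← h3]; ring

end

/-! ### Reduced forms and the classes they represent -/

/-- The reduced forms `3 b x² y + 3 c x y² + d y³` of discriminant `D` with `b`, `c` coprime. -/
def redForms (D : ℤ) : Set CubicForm :=
  {f | f.IsReduced ∧ IsCoprime f.b f.c ∧ f.disc = D}

theorem finite_redForms {D : ℤ} (hD : D ≠ 0) : (redForms D).Finite := by
  have h : ∀ f ∈ redForms D, f.b ≤ |D| := by
    rintro f ⟨hr, -, hf⟩
    rw [CubicForm.disc_of_a_eq_zero hr.a_eq] at hf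
    have hdvd : f.b ∣ D := Dvd.intro _ (by rw [← hf]; ring : f.b * (f.b * (4 * f.b * f.d - 3 * f.c ^ 2)) = D)
    exact Int.le_of_dvd (abs_pos.2 hD) ((dvd_abs _ _).2 hdvd)
  refine Set.Finite.of_finite_image (f := fun f => (f.b, f.c)) ?_ ?_
  · refine ((Set.finite_Icc (0 : ℤ) |D|).prod (Set.finite_Icc (0 : ℤ) (2 * |D|))).subset ?_
    rintro _ ⟨f, hf, rfl⟩
    have := h f hf
    obtain ⟨hr, -, -⟩ := hf
    have h1 := hr.b_pos
    have h2 := hr.c_nonneg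
    have h3 := hr.c_lt
    exact ⟨⟨h1.le, this⟩, ⟨h2, by change f.c ≤ _; omega⟩⟩
  · rintro f ⟨hf, -, hfD⟩ g ⟨hg, -, hgD⟩ e
    simp only [Prod.mk.injEq] at e
    rw [CubicForm.disc_of_a_eq_zero hf.a_eq] at hfD
    rw [CubicForm.disc_of_a_eq_zero hg.a_eq, ← hfD, ← e.1, ← e.2] at hgD
    have hb := hf.b_pos
    have hd : f.d = g.d := by
      have : (4 * f.b ^ 3) * f.d = (4 * f.b ^ 3) * g.d := by linear_combination -hgD
      exact mul_left_cancel₀ (by positivity) this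
    ext
    · rw [hf.a_eq, hg.a_eq]
    · exact e.1
    · exact e.2
    · exact hd

theorem isGen_omega (a b : ℤ) : IsGen (QuadraticAlgebra.omega : QuadraticAlgebra ℤ a b) where
  exists_eq x := ⟨x.re, x.im, by ext <;> simp⟩
  eq_zero m k e := by
    have h1 := congrArg QuadraticAlgebra.re e
    have h2 := congrArg QuadraticAlgebra.im e
    simp at h1 h2
    exact ⟨h1, h2⟩

/-- A form with `a = 0` and coprime `b`, `c` is projective: `ℤ[θ]` carries the triple of its
normal form. -/
theorem CubicForm.isProjective_of_isCoprime {f : CubicForm} (ha : f.a = 0) (hD : f.disc ≠ 0)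
    (hc : IsCoprime f.b f.c) : f.IsProjective := by
  have hb : f.b ≠ 0 := by
    intro hb; apply hD; rw [disc_of_a_eq_zero ha, hb]; ring
  let R := QuadraticAlgebra ℤ (-(f.b ^ 2 * (f.c ^ 2 - f.b * f.d))) (f.b * f.c)
  let θ : R := QuadraticAlgebra.omega
  have hθ : IsGen θ := isGen_omega _ _
  have hsq : θ ^ 2 = ((f.b * f.c : ℤ) : R) * θ - ((f.b ^ 2 * (f.c ^ 2 - f.b * f.d) : ℤ) : R) := by
    rw [pow_two]
    refine QuadraticAlgebra.omega_mul_omega_eq_mk.trans ?_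
    have e : ((f.b ^ 2 * (f.c ^ 2 - f.b * f.d) : ℤ) : R) = ⟨f.b ^ 2 * (f.c ^ 2 - f.b * f.d), 0⟩ := rfl
    have e' : ((f.b * f.c : ℤ) : R) = ⟨f.b * f.c, 0⟩ := rfl
    rw [e, e']
    ext
    · simp [θ, R]
    · simp [θ, R]
  have := hθ.isQuadraticRing
  obtain ⟨π, hπ⟩ := hθ.exists_orientation
  refine ⟨⟨R⟩, π, normalTriple hθ hsq hb, ?_, normalTriple_corresponds hπ hθ hsq ha hb,
    normalTriple_isProjective hθ hsq hb hc⟩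
  change ringDisc R ≠ 0
  rwa [Triple.ringDisc_eq_disc ha hπ hsq]

theorem CubicForm.IsProjective.of_equivalent {f g : CubicForm} (hf : f.IsProjective)
    (h : f.Equivalent g) : g.IsProjective := by
  obtain ⟨R, π, T, hD, hT, hp⟩ := hf
  exact ⟨R, π, T, hD, hT.of_equivalent h, hp⟩

theorem CubicForm.IsProjective.isCoprime {f : CubicForm} (hf : f.IsProjective) (ha : f.a = 0) :
    IsCoprime f.b f.c := by
  obtain ⟨R, π, T, hD, hT, hp⟩ := hf
  exact hT.isCoprime hD ha hp

theorem CubicForm.IsProjective.exists_ringDisc {f : CubicForm} (hf : f.IsProjective) (ha : f.a = 0) :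
    ∃ R : QuadRing, ringDisc R.carrier = f.disc := by
  obtain ⟨R, π, T, hD, hT, hp⟩ := hf
  obtain ⟨-, θ, hθ, hsq, -⟩ := hT.normalForm hD ha
  exact ⟨R, Triple.ringDisc_eq_disc ha hθ hsq⟩

/-- Every projective reducible class contains a reduced form with `b`, `c` coprime. -/
theorem projRedClasses_eq_image {D : ℤ} (hD : D ≠ 0) :
    projRedClasses D = (fun f => (⟦f⟧ : Quotient CubicForm.equivalence)) '' redForms D := by
  ext q
  constructor
  · rintro ⟨f, rfl, hp, hr, rfl⟩
    obtain ⟨g, hg, hgr⟩ := hr.exists_isReduced hD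
    exact ⟨g, ⟨hgr, (hp.of_equivalent hg).isCoprime hgr.a_eq, hg.disc_eq⟩,
      Quotient.sound (CubicForm.equivalent_symm hg)⟩
  · rintro ⟨f, ⟨hr, hc, rfl⟩, rfl⟩
    exact ⟨f, rfl, CubicForm.isProjective_of_isCoprime hr.a_eq hD hc,
      CubicForm.isReducible_of_a_eq_zero hr.a_eq, rfl⟩

theorem finite_projRedClasses {D : ℤ} (hD : D ≠ 0) : (projRedClasses D).Finite := by
  rw [projRedClasses_eq_image hD]
  exact (finite_redForms hD).image _

section
variable {O : Type} [CommRing O]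

/-- `H_red(O)` is the quotient of `redForms (Disc(O))` by `SL₂(ℤ)`-equivalence: a reduced form is
sent to the class of its normal triple. -/
theorem exists_range_eq_hRed [IsQuadraticRing O] (hD : ringDisc O ≠ 0) :
    ∃ Φ : redForms (ringDisc O) → Quotient (Triple.equivalence (O := O)),
      HRed O = Set.range Φ ∧ ∀ f g, Φ f = Φ g ↔ f.1.Equivalent g.1 := by
  obtain ⟨τ, hτ⟩ := exists_isGen O
  obtain ⟨π, -⟩ := hτ.exists_orientation
  have hex : ∀ f : redForms (ringDisc O), ∃ T : Triple O, T.Corresponds π f.1 ∧ T.IsProjective ∧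
      T.δ = 1 := by
    rintro ⟨f, hr, hc, hf⟩
    obtain ⟨θ, hθ, hsq⟩ := exists_theta (π := π) hr.a_eq hf.symm
    have h := isGen_of_orientation π hθ
    exact ⟨normalTriple h hsq hr.b_pos.ne', normalTriple_corresponds hθ h hsq hr.a_eq hr.b_pos.ne',
      normalTriple_isProjective h hsq hr.b_pos.ne' hc, rfl⟩
  choose Φ h1 h2 h3 using hex
  have hequiv : ∀ (f : redForms (ringDisc O)) (T : Triple O), T.Corresponds π f.1 →
      (Φ f).Equivalent T := fun f T hT => (h1 f).triple_equivalent hD hT f.2.1.a_eq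
  refine ⟨fun f => ⟦Φ f⟧, ?_, fun f g => ?_⟩
  · ext q
    constructor
    · rintro ⟨⟨T, rfl, hT⟩, T', hT', ξ, hξ⟩
      have hTT' : T'.Equivalent T := Quotient.exact hT'
      -- scale the triple to `δ = 1`
      have hξpos : 0 < Algebra.norm ℚ ((ξ⁻¹ : (RatAlg O)ˣ) : RatAlg O) := by
        have hn := T'.norm_eq
        rw [hξ, Units.val_pow_eq_pow_val, map_pow] at hn
        have h0 : 0 ≤ Algebra.norm ℚ (ξ : RatAlg O) := by
          have : (0 : ℚ) ≤ idealNorm T'.I := by unfold idealNorm; positivity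
          rw [← (Odd.strictMono_pow (by decide : Odd 3)).injective hn]; exact this
        have h1 : Algebra.norm ℚ ((ξ⁻¹ : (RatAlg O)ˣ) : RatAlg O) * Algebra.norm ℚ (ξ : RatAlg O) = 1 := by
          rw [← map_mul, Units.inv_mul, map_one]
        have : 0 < Algebra.norm ℚ ((ξ⁻¹ : (RatAlg O)ˣ) : RatAlg O) * Algebra.norm ℚ (ξ : RatAlg O) := by
          rw [h1]; norm_num
        exact pos_of_mul_pos_left this h0
      have hT₁ : T'.Equivalent (T'.scale ξ⁻¹ hξpos) := ⟨ξ⁻¹, rfl, rfl⟩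
      obtain ⟨f, hfa, hfT⟩ := (T'.scale ξ⁻¹ hξpos).exists_corresponds_of_delta_eq_one π
        (by change ξ⁻¹ ^ 3 * T'.δ = 1; rw [hξ]; simp)
      have hTf : T.Corresponds π f :=
        (hfT.of_triple_equivalent (Triple.equivalent_symm hT₁)).of_triple_equivalent hTT'
      obtain ⟨hb, θ, hθ, hsq, -⟩ := hTf.normalForm hD hfa
      obtain ⟨g, hfg, hgr⟩ := CubicForm.exists_isReduced_of_a_eq_zero hfa hb
      have hTg := hTf.of_equivalent hfg
      have hg : g ∈ redForms (ringDisc O) := ⟨hgr, hTg.isCoprime hD hgr.a_eq hT, by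
        rw [hfg.disc_eq, Triple.ringDisc_eq_disc hfa hθ hsq]⟩
      exact ⟨⟨g, hg⟩, Quotient.sound (hequiv ⟨g, hg⟩ T hTg)⟩
    · rintro ⟨f, rfl⟩
      exact ⟨⟨Φ f, rfl, h2 f⟩, Φ f, rfl, 1, by rw [h3 f]; simp⟩
  · constructor
    · intro e
      have e' : (Φ f).Equivalent (Φ g) := Quotient.exact e
      exact ((h1 f).of_triple_equivalent e').equivalent (h1 g)
    · intro e
      exact Quotient.sound (hequiv f _ ((h1 g).of_equivalent (CubicForm.equivalent_symm e)))

theorem hRed_eq [IsQuadraticRing O] (hD : ringDisc O ≠ 0) :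
    (HRed O).Finite ∧ (HRed O).ncard = hProjRed (ringDisc O) := by
  obtain ⟨Φ, hΦ, hker⟩ := exists_range_eq_hRed hD
  have hfin : Finite (redForms (ringDisc O)) := finite_redForms hD
  refine ⟨by rw [hΦ]; exact Set.finite_range Φ, ?_⟩
  let Ψ : redForms (ringDisc O) → Quotient CubicForm.equivalence := fun f => ⟦f.1⟧
  have hΨ : projRedClasses (ringDisc O) = Set.range Ψ := by
    rw [projRedClasses_eq_image hD, Set.image_eq_range]
  have hkerΨ : ∀ f g, Φ f = Φ g ↔ Ψ f = Ψ g := fun f g => by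
    rw [hker]; exact ⟨fun h => Quotient.sound h, fun h => Quotient.exact h⟩
  rw [hProjRed, hΦ, hΨ, ← Nat.card_coe_set_eq, ← Nat.card_coe_set_eq]
  refine Nat.card_congr (((Setoid.quotientKerEquivRange Φ).symm.trans
    (Quotient.congr (Equiv.refl _) fun f g => ?_)).trans (Setoid.quotientKerEquivRange Ψ))
  exact hkerΨ f g

end

/-! ### Sums over quadratic rings -/

theorem ringDisc_congr {O O' : Type*} [CommRing O] [CommRing O'] [IsQuadraticRing O]
    [IsQuadraticRing O'] (e : O ≃+* O') : ringDisc O = ringDisc O' := by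
  obtain ⟨τ, h⟩ := exists_isGen O
  obtain ⟨t, n, hsq⟩ := h.exists_sq
  have h' : IsGen (e τ) := by
    refine ⟨fun x => ?_, fun m k hmk => h.eq_zero m k (e.injective (by simpa using hmk))⟩
    obtain ⟨m, k, hx⟩ := h.exists_eq (e.symm x)
    exact ⟨m, k, by rw [← e.apply_symm_apply x, hx]; simp⟩
  have hsq' : e τ ^ 2 = t * e τ - n := by rw [← map_pow, hsq]; simp
  rw [h.ringDisc_eq hsq, h'.ringDisc_eq hsq']

theorem QuadRingClass.disc_injective : Function.Injective QuadRingClass.disc := by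
  intro q q' h
  have : q.rep ≈ q'.rep := ringEquiv_of_ringDisc_eq h
  rw [← Quotient.out_eq (s := QuadRing.iso) q, ← Quotient.out_eq (s := QuadRing.iso) q']
  exact Quotient.sound this

theorem QuadRingClass.exists_disc_eq (R : QuadRing) :
    ∃ q : QuadRingClass, q.disc = ringDisc R.carrier := by
  refine ⟨(Quotient.mk QuadRing.iso R : Quotient QuadRing.iso), ?_⟩
  obtain ⟨e⟩ : (Quotient.mk QuadRing.iso R).out ≈ R := Quotient.mk_out (s := QuadRing.iso) R
  exact ringDisc_congr e

theorem finite_quadRingClass {s : Set ℤ} (hs : s.Finite) :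
    {q : QuadRingClass | q.disc ∈ s}.Finite :=
  hs.preimage QuadRingClass.disc_injective.injOn

theorem finite_posRange (X : ℝ) : (posRange X).Finite := by
  refine (Set.finite_Icc (0 : ℤ) ⌈X⌉).subset fun D hD => ⟨hD.1.le, ?_⟩
  exact_mod_cast (hD.2.trans_le (Int.le_ceil X)).le

theorem finite_negRange (X : ℝ) : (negRange X).Finite := by
  refine (Set.finite_Icc (-⌈X⌉) (0 : ℤ)).subset fun D hD => ⟨?_, by have := hD.1; omega⟩
  have : ((-D : ℤ) : ℝ) ≤ ⌈X⌉ := by push_cast; exact (hD.2.trans_le (Int.le_ceil X)).le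
  have : -D ≤ ⌈X⌉ := by exact_mod_cast this
  omega

/-- The sums agree term by term: the discriminant is injective on isomorphism classes, and an
integer that is not a discriminant has `h = 0`. -/
theorem sumHRed_eq_sumH {s : Set ℤ} (hs : 0 ∉ s) : sumHRed s = sumH s := by
  have h1 : sumHRed s = ∑ᶠ q ∈ QuadRingClass.disc ⁻¹' s, hProjRed (QuadRingClass.disc q) := by
    refine finsum_congr fun q => finsum_congr fun hq => ?_
    have hq0 : q.disc ≠ 0 := fun h0 => hs (h0 ▸ hq)
    exact (hRed_eq (O := q.rep.carrier) hq0).2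
  rw [h1, sumH, ← finsum_mem_image QuadRingClass.disc_injective.injOn,
    Set.image_preimage_eq_inter_range]
  apply finsum_mem_inter_support_eq
  ext D
  simp only [Set.mem_inter_iff, Set.mem_range, Function.mem_support]
  constructor
  · rintro ⟨⟨h1, -⟩, h2⟩; exact ⟨h1, h2⟩
  · rintro ⟨hDs, hD⟩
    refine ⟨⟨hDs, ?_⟩, hD⟩
    have hD0 : D ≠ 0 := fun h0 => hs (h0 ▸ hDs)
    obtain ⟨q, hq⟩ := Set.nonempty_of_ncard_ne_zero hD
    rw [projRedClasses_eq_image hD0] at hq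
    obtain ⟨f, ⟨hr, hc, rfl⟩, -⟩ := hq
    obtain ⟨R, hR⟩ := (CubicForm.isProjective_of_isCoprime hr.a_eq hD0 hc).exists_ringDisc hr.a_eq
    rw [← hR]
    exact QuadRingClass.exists_disc_eq R

/-! ### Counting reduced forms -/

theorem card_divisors_le_two_mul_sqrt (b : ℕ) : b.divisors.card ≤ 2 * Nat.sqrt b := by
  set s := Nat.sqrt b
  rw [← Finset.card_filter_add_card_filter_not (s := b.divisors) (fun d => d ≤ s), two_mul]
  refine add_le_add ?_ ?_
  · calc _ ≤ (Finset.Icc 1 s).card := by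
          refine Finset.card_le_card fun d hd => ?_
          simp only [Finset.mem_filter, Nat.mem_divisors] at hd
          exact Finset.mem_Icc.2 ⟨Nat.pos_of_dvd_of_pos hd.1.1 (Nat.pos_of_ne_zero hd.1.2), hd.2⟩
      _ = s := by simp
  · calc _ ≤ (Finset.Icc 1 s).card := by
          refine Finset.card_le_card_of_injOn (fun d => b / d) (fun d hd => ?_) ?_
          · simp only [Finset.coe_filter, Nat.mem_divisors, Set.mem_ofPred_eq] at hd
            obtain ⟨⟨hdb, hb⟩, hds⟩ := hd
            have hd0 : 0 < d := Nat.pos_of_dvd_of_pos hdb (Nat.pos_of_ne_zero hb)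
            simp only [Finset.coe_Icc, Set.mem_Icc]
            refine ⟨Nat.div_pos (Nat.le_of_dvd (Nat.pos_of_ne_zero hb) hdb) hd0, ?_⟩
            rw [← Nat.lt_succ_iff, Nat.div_lt_iff_lt_mul hd0]
            calc b < (s + 1) * (s + 1) := Nat.lt_succ_sqrt b
              _ ≤ (s + 1) * d := Nat.mul_le_mul_left _ (by omega)
          · intro d hd e he hde
            simp only [Finset.coe_filter, Nat.mem_divisors, Set.mem_ofPred_eq] at hd he
            exact (Nat.div_eq_iff_eq_of_dvd_dvd hd.1.2 hd.1.1 he.1.1).1 hde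
      _ = s := by simp

/-- The admissible middle coefficients `c` of the reduced forms with given `b`. -/
def residues (b : ℕ) : Finset ℕ := (Finset.range (2 * b)).filter b.Coprime

theorem card_residues (b : ℕ) : (residues b).card = 2 * b.totient := by
  have h1 := Nat.filter_coprime_Ico_eq_totient b 0
  have h2 := Nat.filter_coprime_Ico_eq_totient b b
  rw [two_mul, ← h1.trans rfl]
  nth_rewrite 2 [h1]
  rw [← h2, residues, zero_add, ← Finset.card_union_of_disjoint, ← Finset.filter_union,
    Finset.Ico_union_Ico_eq_Ico (Nat.zero_le _) (Nat.le_add_left _ _), ← two_mul, Finset.range_eq_Ico]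
  exact Finset.disjoint_filter_filter (Finset.Ico_disjoint_Ico_consecutive 0 b (b + b))

/-- Two solutions `c, c'` of `3 x² ≡ -n` modulo `b` for which `c - c₀` and `c' - c₀` have the same
gcd `g` with `b` agree modulo `g` and, up to a factor `3`, modulo `b / g`; and `g`, `b / g` have
no common factor beyond `6`. -/
theorem dvd_of_gcd_eq {b c₀ c c' n : ℤ} (hb : b ≠ 0) (h0 : IsCoprime b c₀) (e0 : b ∣ 3 * c₀ ^ 2 + n)
    (e1 : b ∣ 3 * c ^ 2 + n) (e2 : b ∣ 3 * c' ^ 2 + n) (hg : Int.gcd (c - c₀) b = Int.gcd (c' - c₀) b) :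
    b ∣ 18 * (c - c') := by
  have key : ∀ x : ℤ, b ∣ 3 * x ^ 2 + n → ∀ h : ℤ, b = Int.gcd (x - c₀) b * h → h ∣ 3 * (x + c₀) := by
    intro x hx h hh
    have hpos : 0 < Int.gcd (x - c₀) b := Int.gcd_pos_of_ne_zero_right _ hb
    have hd : b ∣ (x - c₀) * (3 * (x + c₀)) := by
      have := dvd_sub hx e0
      rwa [show 3 * x ^ 2 + n - (3 * c₀ ^ 2 + n) = (x - c₀) * (3 * (x + c₀)) by ring] at this
    obtain ⟨k, hk⟩ := Int.gcd_dvd_left (x - c₀) b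
    have hcop : IsCoprime h k := by
      rw [Int.isCoprime_iff_gcd_eq_one]
      have h1 : Int.gcd (Int.gcd (x - c₀) b * k) (Int.gcd (x - c₀) b * h) = Int.gcd (x - c₀) b := by
        rw [← hk, ← hh]
      rw [Int.gcd_mul_left, Int.natAbs_natCast] at h1
      rw [Int.gcd_comm]
      exact Nat.eq_of_mul_eq_mul_left hpos (by rw [h1, mul_one])
    refine hcop.dvd_of_dvd_mul_left ?_
    rw [hk, mul_assoc] at hd
    nth_rewrite 1 [hh] at hd
    exact (mul_dvd_mul_iff_left (by exact_mod_cast hpos.ne')).1 hd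
  obtain ⟨h, hh⟩ := Int.gcd_dvd_right (c - c₀) b
  have k1 := key c e1 h hh
  have k2 := key c' e2 h (by rw [← hg]; exact hh)
  have g1 := Int.gcd_dvd_left (c - c₀) b
  have g2 := Int.gcd_dvd_left (c' - c₀) b
  have gb := Int.gcd_dvd_right (c - c₀) b
  rw [← hg] at g2
  generalize (Int.gcd (c - c₀) b : ℤ) = g at *
  have hgx : g ∣ c - c' := by
    have := dvd_sub g1 g2
    rwa [show c - c₀ - (c' - c₀) = c - c' by ring] at this
  have hhx : h ∣ 3 * (c - c') := by
    have := dvd_sub k1 k2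
    rwa [show 3 * (c + c₀) - 3 * (c' + c₀) = 3 * (c - c') by ring] at this
  have hd6 : (Int.gcd g h : ℤ) ∣ 6 := by
    have d1 : (Int.gcd g h : ℤ) ∣ 6 * c₀ := by
      have := dvd_sub ((Int.gcd_dvd_right g h).trans k1) ((Int.gcd_dvd_left g h).trans (g1.mul_left 3))
      rwa [show 3 * (c + c₀) - 3 * (c - c₀) = 6 * c₀ by ring] at this
    refine IsCoprime.dvd_of_dvd_mul_right ?_ d1
    exact h0.of_isCoprime_of_dvd_left ((Int.gcd_dvd_left g h).trans gb)
  obtain ⟨j, hj⟩ := hd6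
  have hbz := Int.gcd_eq_gcd_ab g h
  have : (18 : ℤ) * (c - c') = j * (g * Int.gcdA g h) * (3 * (c - c'))
      + j * (h * Int.gcdB g h) * 3 * (c - c') := by
    calc (18 : ℤ) * (c - c') = 6 * (3 * (c - c')) := by ring
      _ = _ := by rw [hj, hbz]; ring
  rw [this, hh]
  refine dvd_add ?_ ?_
  · obtain ⟨y, hy⟩ := hhx
    rw [hy]; exact ⟨j * Int.gcdA g h * y, by ring⟩
  · obtain ⟨y, hy⟩ := hgx
    rw [hy]; exact ⟨j * Int.gcdB g h * 3 * y, by ring⟩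

theorem card_residues_dvd_le (b : ℕ) (n : ℤ) :
    ((residues b).filter fun c : ℕ => (b : ℤ) ∣ 3 * c ^ 2 + n).card ≤ 36 * b.divisors.card := by
  set S := (residues b).filter fun c : ℕ => (b : ℤ) ∣ 3 * c ^ 2 + n with hS
  rcases S.eq_empty_or_nonempty with h | ⟨c₀, hc₀⟩
  · rw [h]; simp
  have hmem : ∀ c ∈ S, c < 2 * b ∧ b.Coprime c ∧ (b : ℤ) ∣ 3 * c ^ 2 + n := by
    intro c hc
    simp only [hS, residues, Finset.mem_filter, Finset.mem_range] at hc
    exact ⟨hc.1.1, hc.1.2, hc.2⟩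
  obtain ⟨hlt₀, hcop₀, hd₀⟩ := hmem c₀ hc₀
  have hb : 0 < b := by omega
  have hbz : (b : ℤ) ≠ 0 := by exact_mod_cast hb.ne'
  calc S.card ≤ (Finset.range 36 ×ˢ b.divisors).card := by
        refine Finset.card_le_card_of_injOn
          (fun c => (18 * c / b, Int.gcd ((c : ℤ) - c₀) b)) (fun c hc => ?_) ?_
        · obtain ⟨hlt, hcop, hd⟩ := hmem c hc
          simp only [Finset.coe_product, Set.mem_prod, Finset.mem_coe, Finset.mem_range,
            Nat.mem_divisors]
          refine ⟨?_, ?_, hb.ne'⟩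
          · rw [Nat.div_lt_iff_lt_mul hb]; omega
          · exact_mod_cast Int.gcd_dvd_right ((c : ℤ) - c₀) b
        · intro c hc c' hc' e
          obtain ⟨hlt, hcop, hd⟩ := hmem c hc
          obtain ⟨hlt', hcop', hd'⟩ := hmem c' hc'
          simp only [Prod.mk.injEq] at e
          have hdvd := dvd_of_gcd_eq hbz (Nat.isCoprime_iff_coprime.2 hcop₀) hd₀ hd hd' e.2
          have habs : |(18 : ℤ) * (c - c')| < b := by
            have m1 := Nat.div_add_mod (18 * c) b
            have m2 := Nat.div_add_mod (18 * c') b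
            have m3 := Nat.mod_lt (18 * c) hb
            have m4 := Nat.mod_lt (18 * c') hb
            rw [e.1] at m1
            rw [abs_lt]
            constructor <;> omega
          have := Int.eq_zero_of_abs_lt_dvd hdvd habs
          omega
    _ = 36 * b.divisors.card := by simp

/-- The reduced forms `(0, b, c, ε e)` with `0 < ε disc < X`, given by the pairs `(c, e)`; for a
sign `ε` one has `ε disc = b² (4 b e - 3 ε c²)`. -/
noncomputable def formPairs (ε : ℤ) (b : ℕ) (X : ℝ) : Finset (Σ _ : ℕ, ℤ) :=
  (residues b).sigma fun c => Finset.Ioo ⌊(3 * ε * c ^ 2 / (4 * b) : ℝ)⌋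
    ⌈(3 * ε * c ^ 2 / (4 * b) + X / (4 * b ^ 3) : ℝ)⌉

theorem mem_formPairs {ε : ℤ} {b : ℕ} {X : ℝ} {c : ℕ} {e : ℤ} : ⟨c, e⟩ ∈ formPairs ε b X ↔
    c ∈ residues b ∧ 0 < 4 * b * e - 3 * ε * c ^ 2 ∧
      (b ^ 2 * (4 * b * e - 3 * ε * c ^ 2 : ℤ) : ℝ) < X := by
  simp only [formPairs, Finset.mem_sigma, Finset.mem_Ioo]
  refine and_congr_right fun hc => ?_
  have hb : 0 < b := by
    simp only [residues, Finset.mem_filter, Finset.mem_range] at hc; omega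
  have hb' : (0 : ℝ) < b := by exact_mod_cast hb
  rw [Int.floor_lt, Int.lt_ceil]
  refine and_congr ?_ ?_
  · rw [div_lt_iff₀ (by positivity), ← Int.cast_lt (R := ℝ) (m := 0)]
    push_cast
    constructor <;> intro h <;> linarith
  · rw [div_add_div _ _ (by positivity) (by positivity), lt_div_iff₀ (by positivity)]
    push_cast
    constructor
    · intro h
      have : 4 * b * (b ^ 2 * (4 * b * e - 3 * ε * c ^ 2)) < 4 * b * X := by linarith
      exact lt_of_mul_lt_mul_left this (by positivity)
    · intro h
      have := mul_lt_mul_of_pos_left h (by positivity : (0 : ℝ) < 4 * b)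
      linarith

theorem abs_card_Ioo_floor_ceil_sub_le {u v : ℝ} (h : u ≤ v) :
    |((Finset.Ioo ⌊u⌋ ⌈v⌉).card : ℝ) - (v - u)| ≤ 1 := by
  rw [Int.card_Ioo]
  have h1 := Int.floor_le u
  have h2 := Int.lt_floor_add_one u
  have h3 := Int.le_ceil v
  have h4 := Int.ceil_lt_add_one v
  have h5 : (((⌈v⌉ - ⌊u⌋ - 1).toNat : ℤ) : ℝ) = max (⌈v⌉ - ⌊u⌋ - 1 : ℝ) 0 := by
    rw [Int.ofNat_toNat]; push_cast; rfl
  rw [Int.cast_natCast] at h5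
  rw [h5, abs_le]
  constructor
  · have := le_max_left (⌈v⌉ - ⌊u⌋ - 1 : ℝ) 0
    linarith
  · have : max (⌈v⌉ - ⌊u⌋ - 1 : ℝ) 0 ≤ v - u + 1 := max_le (by linarith) (by linarith)
    linarith

theorem abs_card_formPairs_sub_le (ε : ℤ) (b : ℕ) {X : ℝ} (hX : 0 ≤ X) :
    |((formPairs ε b X).card : ℝ) - b.totient / (2 * b ^ 3) * X| ≤ (2 * b.totient : ℝ) := by
  have h1 : b.totient / (2 * b ^ 3) * X = ∑ c ∈ residues b, X / (4 * b ^ 3) := by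
    rw [Finset.sum_const, card_residues, nsmul_eq_mul]
    rcases eq_or_ne b 0 with rfl | hb
    · simp
    · have : (b : ℝ) ≠ 0 := by exact_mod_cast hb
      push_cast; field_simp; ring
  rw [formPairs, Finset.card_sigma, h1, Nat.cast_sum, ← Finset.sum_sub_distrib]
  refine (Finset.abs_sum_le_sum_abs _ _).trans ?_
  calc _ ≤ ∑ c ∈ residues b, (1 : ℝ) := by
        refine Finset.sum_le_sum fun c _ => ?_
        have := abs_card_Ioo_floor_ceil_sub_le
          (u := 3 * ε * c ^ 2 / (4 * b)) (v := 3 * ε * c ^ 2 / (4 * b) + X / (4 * b ^ 3))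
          (by linarith [show 0 ≤ X / (4 * b ^ 3) by positivity])
        rwa [add_sub_cancel_left] at this
    _ = _ := by rw [Finset.sum_const, card_residues]; simp

/-- A bound that is uniform in `b` and linear in `X`: group the forms by discriminant. -/
theorem card_formPairs_le {ε : ℤ} (hε : ε ^ 2 = 1) {b : ℕ} (hb : 0 < b) {X : ℝ} (hX : 0 ≤ X) :
    ((formPairs ε b X).card : ℝ) ≤ 72 * Real.sqrt b / b ^ 2 * X := by
  have hb' : (0 : ℝ) < b := by exact_mod_cast hb
  have hcard : (formPairs ε b X).card ≤ 72 * Nat.sqrt b * (Finset.Ioc 0 ⌊X / b ^ 2⌋).card := by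
    refine Finset.card_le_mul_card_image_of_maps_to
      (f := fun p : Σ _ : ℕ, ℤ => 4 * (b : ℤ) * p.2 - 3 * ε * p.1 ^ 2) ?_ _ ?_
    · rintro ⟨c, e⟩ hp
      obtain ⟨-, h1, h2⟩ := mem_formPairs.1 hp
      refine Finset.mem_Ioc.2 ⟨h1, ?_⟩
      rw [Int.le_floor, le_div_iff₀ (by positivity), mul_comm]
      exact h2.le
    · intro n _
      calc _ ≤ ((residues b).filter fun c : ℕ => (b : ℤ) ∣ 3 * c ^ 2 + ε * n).card := by
            refine Finset.card_le_card_of_injOn (fun p => p.1) ?_ ?_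
            · rintro ⟨c, e⟩ hp
              simp only [Finset.coe_filter, Set.mem_ofPred_eq] at hp ⊢
              refine ⟨(mem_formPairs.1 hp.1).1, 4 * ε * e, ?_⟩
              rw [← hp.2]; linear_combination -3 * (c : ℤ) ^ 2 * hε
            · rintro ⟨c, e⟩ hp ⟨c', e'⟩ hp' heq
              simp only [Finset.coe_filter, Set.mem_ofPred_eq] at hp hp' heq
              subst heq
              have h1 : 4 * (b : ℤ) * e = 4 * b * e' := by linarith [hp.2, hp'.2]
              have h2 : e = e' := mul_left_cancel₀ (by positivity) h1
              rw [h2]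
        _ ≤ 36 * b.divisors.card := card_residues_dvd_le b _
        _ ≤ 36 * (2 * Nat.sqrt b) := Nat.mul_le_mul_left _ (card_divisors_le_two_mul_sqrt b)
        _ = 72 * Nat.sqrt b := by ring
  have hfl : (((Finset.Ioc 0 ⌊X / b ^ 2⌋).card : ℕ) : ℝ) ≤ X / b ^ 2 := by
    rw [Int.card_Ioc, sub_zero]
    have h0 : 0 ≤ ⌊X / (b : ℝ) ^ 2⌋ := Int.floor_nonneg.2 (by positivity)
    have : ((⌊X / (b : ℝ) ^ 2⌋.toNat : ℤ) : ℝ) = ⌊X / (b : ℝ) ^ 2⌋ := by rw [Int.toNat_of_nonneg h0]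
    rw [Int.cast_natCast] at this
    rw [this]; exact Int.floor_le _
  calc ((formPairs ε b X).card : ℝ) ≤ 72 * Nat.sqrt b * (Finset.Ioc 0 ⌊X / b ^ 2⌋).card := by
        exact_mod_cast hcard
    _ ≤ 72 * Real.sqrt b * (X / b ^ 2) := by
        have := Real.nat_sqrt_le_real_sqrt (a := b)
        gcongr
    _ = _ := by ring

/-- The pairs of `formPairs` for which `-3 disc` is not a square. -/
noncomputable def goodPairs (ε : ℤ) (b : ℕ) (X : ℝ) : Finset (Σ _ : ℕ, ℤ) :=
  open Classical in (formPairs ε b X).filter fun p =>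
    ¬ IsSquare (-3 * (ε * (b ^ 2 * (4 * b * p.2 - 3 * ε * p.1 ^ 2))))

theorem goodPairs_subset (ε : ℤ) (b : ℕ) (X : ℝ) : goodPairs ε b X ⊆ formPairs ε b X :=
  Finset.filter_subset _ _

/-- For fixed `b` only `O(√X)` forms have `-3 disc` a square. -/
theorem card_formPairs_le_card_goodPairs {ε : ℤ} (hε : ε ^ 2 = 1) (b : ℕ) (X : ℝ) :
    (formPairs ε b X).card ≤ (goodPairs ε b X).card + 2 * b * (Nat.sqrt ⌊3 * X⌋₊ + 1) := by
  classical
  have h1 := Finset.card_filter_add_card_filter_not (s := formPairs ε b X) (fun p =>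
    IsSquare (-3 * (ε * ((b : ℤ) ^ 2 * (4 * b * p.2 - 3 * ε * p.1 ^ 2)))))
  have h2 : ((formPairs ε b X).filter fun p =>
      IsSquare (-3 * (ε * ((b : ℤ) ^ 2 * (4 * b * p.2 - 3 * ε * p.1 ^ 2))))).card ≤
      (Finset.range (2 * b) ×ˢ Finset.range (Nat.sqrt ⌊3 * X⌋₊ + 1)).card := by
    refine Finset.card_le_card_of_injOn (fun p =>
      (p.1, Nat.sqrt (-3 * (ε * ((b : ℤ) ^ 2 * (4 * b * p.2 - 3 * ε * p.1 ^ 2)))).toNat)) ?_ ?_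
    · rintro ⟨c, e⟩ hp
      simp only [Finset.coe_filter, Set.mem_ofPred_eq] at hp
      obtain ⟨⟨hc, h3, h4⟩, hsq⟩ := And.imp_left mem_formPairs.1 hp
      simp only [residues, Finset.mem_filter, Finset.mem_range] at hc
      simp only [Finset.coe_product, Set.mem_prod, Finset.mem_coe, Finset.mem_range]
      refine ⟨hc.1, Nat.lt_succ_of_le (Nat.sqrt_le_sqrt (Nat.le_floor ?_))⟩
      have h5 : -3 * (ε * ((b : ℤ) ^ 2 * (4 * b * e - 3 * ε * c ^ 2))) ≤
          3 * ((b : ℤ) ^ 2 * (4 * b * e - 3 * ε * c ^ 2)) := by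
        have h6 : 0 ≤ (b : ℤ) ^ 2 * (4 * b * e - 3 * ε * c ^ 2) := by positivity
        have h7 : -1 ≤ ε := by nlinarith
        nlinarith
      have h8 := Int.toNat_of_nonneg hsq.nonneg
      rw [← Int.cast_natCast, h8]
      calc _ ≤ ((3 * ((b : ℤ) ^ 2 * (4 * b * e - 3 * ε * c ^ 2)) : ℤ) : ℝ) := by exact_mod_cast h5
        _ = 3 * (b ^ 2 * (4 * b * e - 3 * ε * c ^ 2 : ℤ) : ℝ) := by push_cast; ring
        _ ≤ 3 * X := by linarith
    · rintro ⟨c, e⟩ hp ⟨c', e'⟩ hp' heq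
      simp only [Finset.coe_filter, Set.mem_ofPred_eq, Prod.mk.injEq] at hp hp' heq
      obtain ⟨rfl, heq⟩ := heq
      have key : ∀ z : ℤ, IsSquare z → z = (Nat.sqrt z.toNat : ℤ) ^ 2 := by
        rintro _ ⟨k, rfl⟩
        rw [← Int.natAbs_mul_self, Int.toNat_natCast, Nat.sqrt_eq]; push_cast; ring
      have h3 := key _ hp.2
      have h4 := key _ hp'.2
      rw [heq, ← h4] at h3
      have hc := (mem_formPairs.1 hp.1).1
      simp only [residues, Finset.mem_filter, Finset.mem_range] at hc
      have hb : (b : ℤ) ≠ 0 := by omega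
      have hε0 : ε ≠ 0 := by rintro rfl; norm_num at hε
      have h5 : e = e' := by
        have : (-12 * ε * (b : ℤ) ^ 3) * e = (-12 * ε * (b : ℤ) ^ 3) * e' := by
          linear_combination h3
        exact mul_left_cancel₀ (mul_ne_zero (mul_ne_zero (by norm_num) hε0) (pow_ne_zero 3 hb)) this
      rw [h5]
  rw [Finset.card_product, Finset.card_range, Finset.card_range] at h2
  have h3 : (goodPairs ε b X).card = ((formPairs ε b X).filter fun p =>
      ¬ IsSquare (-3 * (ε * ((b : ℤ) ^ 2 * (4 * b * p.2 - 3 * ε * p.1 ^ 2))))).card := by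
    rw [goodPairs]
  omega

/-! ### The sums as sums over reduced forms -/

section
open Filter Topology

/-- The integers `D` with `0 < ε D < X`. -/
def signRange (ε : ℤ) (X : ℝ) : Set ℤ := {D | 0 < ε * D ∧ ((ε * D : ℤ) : ℝ) < X}

theorem posRange_eq (X : ℝ) : posRange X = signRange 1 X := by
  ext D; simp [posRange, signRange]

theorem negRange_eq (X : ℝ) : negRange X = signRange (-1) X := by
  ext D; simp [negRange, signRange]

theorem formPairs_eq_empty {ε : ℤ} {b : ℕ} {X : ℝ} (h : X ≤ b) : formPairs ε b X = ∅ := by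
  rw [Finset.eq_empty_iff_forall_notMem]
  rintro ⟨c, e⟩ hp
  obtain ⟨hc, h1, h2⟩ := mem_formPairs.1 hp
  simp only [residues, Finset.mem_filter, Finset.mem_range] at hc
  have hb : (1 : ℝ) ≤ b := by
    have : 1 ≤ b := by omega
    exact_mod_cast this
  have h3 : (1 : ℝ) ≤ (4 * b * e - 3 * ε * c ^ 2 : ℤ) := by exact_mod_cast h1
  nlinarith [mul_le_mul_of_nonneg_left h3 (by positivity : (0 : ℝ) ≤ b ^ 2)]

/-- The form `(0, b, c, ε e)`. -/
def toForm (ε : ℤ) (p : Σ _ : ℕ, Σ _ : ℕ, ℤ) : CubicForm := ⟨0, p.1, p.2.1, ε * p.2.2⟩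

theorem disc_toForm {ε : ℤ} (hε : ε ^ 2 = 1) (p : Σ _ : ℕ, Σ _ : ℕ, ℤ) : (toForm ε p).disc =
    ε * ((p.1 : ℤ) ^ 2 * (4 * p.1 * p.2.2 - 3 * ε * p.2.1 ^ 2)) := by
  rw [CubicForm.disc_of_a_eq_zero rfl]
  simp only [toForm]
  linear_combination (3 * (p.1 : ℤ) ^ 2 * p.2.1 ^ 2) * hε

theorem toForm_mem {ε : ℤ} (hε : ε ^ 2 = 1) {b : ℕ} {p : Σ _ : ℕ, ℤ} {X : ℝ}
    (hp : p ∈ formPairs ε b X) : toForm ε ⟨b, p⟩ ∈ redForms (toForm ε ⟨b, p⟩).disc ∧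
      (toForm ε ⟨b, p⟩).disc ∈ signRange ε X := by
  obtain ⟨c, e⟩ := p
  obtain ⟨hc, h1, h2⟩ := mem_formPairs.1 hp
  simp only [residues, Finset.mem_filter, Finset.mem_range] at hc
  have hb : 0 < b := by omega
  refine ⟨⟨⟨rfl, ?_, ?_, ?_⟩, Nat.isCoprime_iff_coprime.2 hc.2, rfl⟩, ?_⟩
  · simpa [toForm] using hb
  · simp [toForm]
  · simp only [toForm]; omega
  · have e1 : ε * (toForm ε ⟨b, ⟨c, e⟩⟩).disc = (b : ℤ) ^ 2 * (4 * b * e - 3 * ε * c ^ 2) := by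
      rw [disc_toForm hε, ← mul_assoc, ← pow_two, hε, one_mul]
    rw [signRange, Set.mem_ofPred_eq, e1]
    refine ⟨by positivity, ?_⟩
    push_cast at h2 ⊢; exact h2

theorem exists_toForm {ε : ℤ} (hε : ε ^ 2 = 1) {D : ℤ} {X : ℝ} {f : CubicForm} (hf : f ∈ redForms D)
    (hD : D ∈ signRange ε X) : ∃ b : ℕ, ∃ p ∈ formPairs ε b X, toForm ε ⟨b, p⟩ = f := by
  obtain ⟨⟨ha, hb, hc0, hc⟩, hcop, rfl⟩ := hf
  obtain ⟨h1, h2⟩ := hD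
  obtain ⟨a, b, c, d⟩ := f
  simp only at ha hb hc0 hc hcop
  subst ha
  lift b to ℕ using hb.le
  lift c to ℕ using hc0
  have hfe : toForm ε ⟨b, ⟨c, ε * d⟩⟩ = ⟨0, b, c, d⟩ := by
    simp only [toForm, CubicForm.mk.injEq, true_and]
    rw [← mul_assoc, ← pow_two, hε, one_mul]
  refine ⟨b, ⟨c, ε * d⟩, mem_formPairs.2 ⟨?_, ?_⟩, hfe⟩
  · simp only [residues, Finset.mem_filter, Finset.mem_range]
    exact ⟨by omega, Nat.isCoprime_iff_coprime.1 hcop⟩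
  · have e1 : ε * (⟨0, b, c, d⟩ : CubicForm).disc =
        (b : ℤ) ^ 2 * (4 * b * (ε * d) - 3 * ε * c ^ 2) := by
      rw [← hfe, disc_toForm hε, ← mul_assoc, ← pow_two, hε, one_mul]
    rw [e1] at h1 h2
    refine ⟨pos_of_mul_pos_right h1 (by positivity), ?_⟩
    push_cast at h2 ⊢; exact h2

theorem toForm_injective {ε : ℤ} (hε : ε ^ 2 = 1) : Function.Injective (toForm ε) := by
  rintro ⟨b, c, e⟩ ⟨b', c', e'⟩ h
  simp only [toForm, CubicForm.mk.injEq, true_and, Nat.cast_inj] at h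
  obtain ⟨rfl, rfl, h⟩ := h
  have hε0 : ε ≠ 0 := by rintro rfl; norm_num at hε
  rw [mul_left_cancel₀ hε0 h]

theorem finite_signRange {ε : ℤ} (hε : ε ^ 2 = 1) (X : ℝ) : (signRange ε X).Finite := by
  rcases mul_self_eq_one_iff.1 (by rw [← hε]; ring : ε * ε = 1) with rfl | rfl
  · rw [← posRange_eq]; exact finite_posRange X
  · rw [← negRange_eq]; exact finite_negRange X

/-- Up to classes with several reduced forms, whose discriminants satisfy `-3 D = □`, the sum of the
class numbers counts the reduced forms. -/
theorem sumH_bounds {ε : ℤ} (hε : ε ^ 2 = 1) (X : ℝ) :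
    ∑ b ∈ Finset.range ⌈X⌉₊, (goodPairs ε b X).card ≤ sumH (signRange ε X) ∧
      sumH (signRange ε X) ≤ ∑ b ∈ Finset.range ⌈X⌉₊, (formPairs ε b X).card := by
  classical
  have hfin := finite_signRange hε X
  have h0 : ∀ D ∈ signRange ε X, D ≠ 0 := by
    rintro D ⟨h1, -⟩ rfl; simp at h1
  rw [sumH, finsum_mem_eq_finite_toFinset_sum _ hfin, ← Finset.card_sigma, ← Finset.card_sigma]
  set T := (Finset.range ⌈X⌉₊).sigma fun b => formPairs ε b X with hT
  set G := (Finset.range ⌈X⌉₊).sigma fun b => goodPairs ε b X with hG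
  have hGT : ∀ p ∈ G, p ∈ T := by
    intro p hp
    rw [hG, Finset.mem_sigma] at hp
    exact Finset.mem_sigma.2 ⟨hp.1, goodPairs_subset _ _ _ hp.2⟩
  have hTmem : ∀ p ∈ T, toForm ε p ∈ redForms (toForm ε p).disc ∧
      (toForm ε p).disc ∈ signRange ε X := by
    rintro ⟨b, p⟩ hp
    exact toForm_mem hε (Finset.mem_sigma.1 hp).2
  have hmaps : ∀ p ∈ T, (toForm ε p).disc ∈ hfin.toFinset := fun p hp =>
    hfin.mem_toFinset.2 (hTmem p hp).2
  constructor
  · rw [Finset.card_eq_sum_card_fiberwise (f := fun p => (toForm ε p).disc) (t := hfin.toFinset)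
      fun p hp => hmaps p (hGT p hp)]
    refine Finset.sum_le_sum fun D hD => ?_
    have hD0 := h0 D (hfin.mem_toFinset.1 hD)
    rw [hProjRed, Set.ncard_eq_toFinset_card _ (finite_projRedClasses hD0)]
    refine Finset.card_le_card_of_injOn (fun p => (⟦toForm ε p⟧ : Quotient CubicForm.equivalence)) ?_ ?_
    · intro p hp
      simp only [Finset.coe_filter, Set.mem_ofPred_eq] at hp
      have h1 := (hTmem p (hGT p hp.1)).1
      rw [hp.2] at h1
      rw [Set.Finite.coe_toFinset, projRedClasses_eq_image hD0]
      exact ⟨_, h1, rfl⟩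
    · intro p hp q hq hpq
      simp only [Finset.coe_filter, Set.mem_ofPred_eq] at hp hq
      have h1 := (hTmem p (hGT p hp.1)).1.1
      have h2 := (hTmem q (hGT q hq.1)).1.1
      refine toForm_injective hε (h1.eq_of_equivalent h2 (Quotient.exact hpq) ?_)
      have h3 := (Finset.mem_sigma.1 hp.1).2
      rw [goodPairs, Finset.mem_filter] at h3
      rw [disc_toForm hε]
      exact h3.2
  · rw [Finset.card_eq_sum_card_fiberwise (f := fun p => (toForm ε p).disc) (t := hfin.toFinset)
      fun p hp => hmaps p hp]
    refine Finset.sum_le_sum fun D hD => ?_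
    have hDX := hfin.mem_toFinset.1 hD
    have hD0 := h0 D hDX
    have hsub : projRedClasses D ⊆ ((T.filter fun p => (toForm ε p).disc = D).image
        (fun p => (⟦toForm ε p⟧ : Quotient CubicForm.equivalence)) : Finset _) := by
      rw [projRedClasses_eq_image hD0]
      rintro _ ⟨f, hf, rfl⟩
      obtain ⟨b, p, hp, rfl⟩ := exists_toForm hε hf hDX
      rw [Finset.mem_coe, Finset.mem_image]
      refine ⟨⟨b, p⟩, ?_, rfl⟩
      rw [Finset.mem_filter]
      refine ⟨Finset.mem_sigma.2 ⟨?_, hp⟩, hf.2.2⟩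
      rw [Finset.mem_range, Nat.lt_ceil]
      by_contra! hc
      change p ∈ formPairs ε b X at hp
      rw [formPairs_eq_empty hc] at hp
      simp at hp
    calc hProjRed D ≤ _ := Set.ncard_le_ncard hsub (Finset.finite_toSet _)
      _ = _ := Set.ncard_coe_finset _
      _ ≤ _ := Finset.card_image_le

/-! ### The asymptotic formula -/

theorem tendsto_card_formPairs_div (ε : ℤ) (b : ℕ) :
    Tendsto (fun X : ℝ => ((formPairs ε b X).card : ℝ) / X) atTop (𝓝 (b.totient / (2 * b ^ 3))) := by
  rw [tendsto_iff_norm_sub_tendsto_zero]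
  refine squeeze_zero' (Eventually.of_forall fun _ => norm_nonneg _) ?_
    (tendsto_const_nhds (x := (2 * b.totient : ℝ)).div_atTop tendsto_id)
  filter_upwards [eventually_gt_atTop 0] with X hX
  have := abs_card_formPairs_sub_le ε b hX.le
  rw [Real.norm_eq_abs, id, le_div_iff₀ hX]
  calc _ = |((formPairs ε b X).card : ℝ) / X - b.totient / (2 * b ^ 3)| * |X| := by
        rw [abs_of_pos hX]
    _ = |((formPairs ε b X).card : ℝ) - b.totient / (2 * b ^ 3) * X| := by
        rw [← abs_mul, sub_mul, div_mul_cancel₀ _ hX.ne']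
    _ ≤ _ := this

theorem tendsto_card_goodPairs_div {ε : ℤ} (hε : ε ^ 2 = 1) (b : ℕ) :
    Tendsto (fun X : ℝ => ((goodPairs ε b X).card : ℝ) / X) atTop (𝓝 (b.totient / (2 * b ^ 3))) := by
  have h := tendsto_card_formPairs_div ε b
  have hlow : Tendsto (fun X : ℝ => ((formPairs ε b X).card : ℝ) / X -
      2 * b * (Real.sqrt (3 * X) + 1) / X) atTop (𝓝 (b.totient / (2 * b ^ 3))) := by
    have h1 : Tendsto (fun X : ℝ => 2 * b * (Real.sqrt (3 * X) + 1) / X) atTop (𝓝 0) := by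
      have h2 : Tendsto (fun X : ℝ => 2 * b * Real.sqrt 3 / Real.sqrt X + 2 * b / X) atTop (𝓝 (0 + 0)) :=
        (tendsto_const_nhds.div_atTop Real.tendsto_sqrt_atTop).add
          (tendsto_const_nhds.div_atTop tendsto_id)
      rw [add_zero] at h2
      refine h2.congr' ?_
      filter_upwards [eventually_gt_atTop 0] with X hX
      have h3 := Real.mul_self_sqrt hX.le
      have h4 : 0 < Real.sqrt X := Real.sqrt_pos.2 hX
      rw [Real.sqrt_mul (by norm_num)]
      nth_rewrite 4 [← h3]
      nth_rewrite 2 [← h3]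
      field_simp
    simpa using h.sub h1
  refine tendsto_of_tendsto_of_tendsto_of_le_of_le' hlow h ?_ ?_
  · filter_upwards [eventually_gt_atTop 0] with X hX
    have h1 := card_formPairs_le_card_goodPairs hε b X
    have h2 : ((Nat.sqrt ⌊3 * X⌋₊ : ℕ) : ℝ) ≤ Real.sqrt (3 * X) :=
      Real.nat_sqrt_le_real_sqrt.trans (Real.sqrt_le_sqrt (Nat.floor_le (by positivity)))
    have h3 : ((formPairs ε b X).card : ℝ) ≤ (goodPairs ε b X).card +
        2 * b * (Nat.sqrt ⌊3 * X⌋₊ + 1) := by exact_mod_cast h1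
    rw [← sub_div]
    gcongr
    nlinarith [mul_le_mul_of_nonneg_left h2 (by positivity : (0 : ℝ) ≤ 2 * b)]
  · filter_upwards [eventually_gt_atTop 0] with X hX
    gcongr
    exact goodPairs_subset ε b X

theorem tendsto_tsum_card_div {N : ℕ → ℝ → ℕ} {ε : ℤ} (hε : ε ^ 2 = 1)
    (hN : ∀ b X, N b X ≤ (formPairs ε b X).card)
    (hlim : ∀ b, Tendsto (fun X : ℝ => (N b X : ℝ) / X) atTop (𝓝 (b.totient / (2 * b ^ 3)))) :
    Tendsto (fun X : ℝ => ((∑ b ∈ Finset.range ⌈X⌉₊, N b X : ℕ) : ℝ) / X) atTop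
      (𝓝 (∑' b : ℕ, (b.totient : ℝ) / (2 * b ^ 3))) := by
  have hsum : Summable fun b : ℕ => 72 * (b : ℝ) ^ (-(3 / 2) : ℝ) :=
    (Real.summable_nat_rpow.2 (by norm_num)).mul_left 72
  have hT := tendsto_tsum_of_dominated_convergence hsum hlim (by
    filter_upwards [eventually_gt_atTop 0] with X hX b
    rcases Nat.eq_zero_or_pos b with rfl | hb
    · have : N 0 X = 0 := by
        have := hN 0 X
        rw [formPairs, residues] at this
        simpa using this
      rw [this]; simp
    · have hb' : (0 : ℝ) < b := by exact_mod_cast hb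
      rw [Real.norm_of_nonneg (by positivity), div_le_iff₀ hX]
      calc (N b X : ℝ) ≤ (formPairs ε b X).card := by exact_mod_cast hN b X
        _ ≤ 72 * Real.sqrt b / b ^ 2 * X := card_formPairs_le hε hb hX.le
        _ = _ := by
          have : (b : ℝ) ^ (-(3 / 2) : ℝ) = Real.sqrt b / b ^ 2 := by
            rw [Real.sqrt_eq_rpow, ← Real.rpow_natCast, ← Real.rpow_sub hb']; norm_num
          rw [this]; ring)
  refine hT.congr fun X => ?_
  rw [tsum_eq_sum (s := Finset.range ⌈X⌉₊), Nat.cast_sum, Finset.sum_div]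
  intro b hb
  rw [Finset.mem_range, Nat.lt_ceil, not_lt] at hb
  have := hN b X
  rw [formPairs_eq_empty hb] at this
  have h0 : N b X = 0 := by simpa using this
  rw [h0]; simp

/-- `∑ φ(b) b⁻³ = ζ(2) / ζ(3)`, as `φ * 1 = id` under Dirichlet convolution. -/
theorem tsum_totient_div : (((∑' b : ℕ, (b.totient : ℝ) / (2 * b ^ 3) : ℝ)) : ℂ) =
    riemannZeta 2 / (2 * riemannZeta 3) := by
  have h3 : (1 : ℝ) < (3 : ℂ).re := by norm_num
  have hterm : ∀ f : ℕ → ℂ, ∀ n, LSeries.term f 3 n = f n / (n : ℂ) ^ 3 := by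
    intro f n
    rcases eq_or_ne n 0 with rfl | hn
    · simp
    · rw [LSeries.term_of_ne_zero hn]; norm_cast
  have hid : ∀ n : ℕ, LSeries.term (fun n : ℕ => (n : ℂ)) 3 n = 1 / (n : ℂ) ^ 2 := by
    intro n
    rw [hterm]
    rcases eq_or_ne n 0 with rfl | hn
    · simp
    · have : (n : ℂ) ≠ 0 := by exact_mod_cast hn
      field_simp
  have hsum_id : Summable fun n : ℕ => 1 / (n : ℝ) ^ 2 := Real.summable_one_div_nat_pow.2 one_lt_two
  have hsum : LSeriesSummable (fun n => (n.totient : ℂ)) 3 := by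
    refine Summable.of_norm_bounded hsum_id fun n => ?_
    rw [hterm]
    rcases eq_or_ne n 0 with rfl | hn
    · simp
    · have hn' : (0 : ℝ) < n := by exact_mod_cast Nat.pos_of_ne_zero hn
      rw [norm_div, norm_pow, Complex.norm_natCast, Complex.norm_natCast,
        div_le_div_iff₀ (by positivity) (by positivity), one_mul, pow_succ', mul_comm]
      have : (n.totient : ℝ) ≤ n := by exact_mod_cast Nat.totient_le n
      nlinarith [pow_pos hn' 2]
  have hconv := LSeries_convolution' hsum (LSeriesSummable_one_iff.2 h3)
  have hfun : LSeries.convolution (fun n => (n.totient : ℂ)) 1 = fun n : ℕ => (n : ℂ) := by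
    ext n
    rw [LSeries.convolution_def]
    simp only [Pi.one_apply, mul_one]
    rw [Nat.sum_divisorsAntidiagonal (f := fun d _ => (d.totient : ℂ))]
    exact_mod_cast Nat.sum_totient n
  rw [hfun, LSeries_one_eq_riemannZeta h3] at hconv
  have hz2 : LSeries (fun n : ℕ => (n : ℂ)) 3 = riemannZeta 2 := by
    have := zeta_nat_eq_tsum_of_gt_one (k := 2) one_lt_two
    rw [Nat.cast_ofNat] at this
    rw [this, LSeries]
    exact tsum_congr hid
  have hφ : (((∑' b : ℕ, (b.totient : ℝ) / (2 * b ^ 3) : ℝ)) : ℂ) =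
      LSeries (fun n => (n.totient : ℂ)) 3 / 2 := by
    rw [Complex.ofReal_tsum, LSeries, ← tsum_div_const]
    refine tsum_congr fun n => ?_
    rw [hterm]; push_cast; ring
  have hz3 := riemannZeta_ne_zero_of_one_lt_re h3
  rw [hφ, ← hz2, hconv]
  field_simp

theorem tendsto_sumH_div {ε : ℤ} (hε : ε ^ 2 = 1) :
    Tendsto (fun X : ℝ => (sumH (signRange ε X) : ℝ) / X) atTop
      (𝓝 (∑' b : ℕ, (b.totient : ℝ) / (2 * b ^ 3))) := by
  refine tendsto_of_tendsto_of_tendsto_of_le_of_le'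
    (tendsto_tsum_card_div (N := fun b X => (goodPairs ε b X).card) hε
      (fun b X => Finset.card_le_card (goodPairs_subset ε b X)) (tendsto_card_goodPairs_div hε))
    (tendsto_tsum_card_div (N := fun b X => (formPairs ε b X).card) hε
      (fun b X => le_rfl) (tendsto_card_formPairs_div ε)) ?_ ?_
  · filter_upwards [eventually_gt_atTop 0] with X hX
    gcongr
    exact (sumH_bounds hε X).1
  · filter_upwards [eventually_gt_atTop 0] with X hX
    gcongr
    exact (sumH_bounds hε X).2

theorem sumH_isLittleO {ε : ℤ} (hε : ε ^ 2 = 1) :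
    (fun X : ℝ => (sumH (signRange ε X) : ℂ) -
        riemannZeta 2 / (2 * riemannZeta 3) * (X : ℂ)) =o[atTop] fun X : ℝ => X := by
  rw [← tsum_totient_div]
  set L := ∑' b : ℕ, (b.totient : ℝ) / (2 * b ^ 3)
  have h1 : (fun X : ℝ => (sumH (signRange ε X) : ℝ) - L * X) =o[atTop] fun X : ℝ => X := by
    rw [Asymptotics.isLittleO_iff_tendsto' (by
      filter_upwards [eventually_gt_atTop 0] with X hX h0; exact absurd h0 hX.ne')]
    have := (tendsto_sumH_div hε).sub_const L
    rw [sub_self] at this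
    refine this.congr' ?_
    filter_upwards [eventually_gt_atTop 0] with X hX
    field_simp
  refine (Asymptotics.isBigO_of_le _ fun X => ?_).trans_isLittleO h1
  rw [← Complex.norm_real]
  push_cast
  exact le_rfl

end

end CubicCount

theorem mainTheorem7 :
    -- all the numbers involved are finite, and `|H_red(O)| = h_{proj,red}(Disc(O))`
    (∀ D : ℤ, D ≠ 0 → (CubicCount.projRedClasses D).Finite) ∧
    (∀ (O : Type) [CommRing O] [CubicCount.IsQuadraticRing O], CubicCount.ringDisc O ≠ 0 →
      (CubicCount.HRed O).Finite ∧
      (CubicCount.HRed O).ncard = CubicCount.hProjRed (CubicCount.ringDisc O)) ∧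
    (∀ X : ℝ, {q : CubicCount.QuadRingClass | q.disc ∈ CubicCount.posRange X}.Finite ∧
      {q : CubicCount.QuadRingClass | q.disc ∈ CubicCount.negRange X}.Finite) ∧
    -- positive discriminants
    (∀ X : ℝ, CubicCount.sumHRed (CubicCount.posRange X) =
      CubicCount.sumH (CubicCount.posRange X)) ∧
    ((fun X : ℝ => (CubicCount.sumH (CubicCount.posRange X) : ℂ) -
        riemannZeta 2 / (2 * riemannZeta 3) * (X : ℂ)) =o[Filter.atTop] fun X : ℝ => X) ∧
    -- negative discriminants
    (∀ X : ℝ, CubicCount.sumHRed (CubicCount.negRange X) =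
      CubicCount.sumH (CubicCount.negRange X)) ∧
    ((fun X : ℝ => (CubicCount.sumH (CubicCount.negRange X) : ℂ) -
        riemannZeta 2 / (2 * riemannZeta 3) * (X : ℂ)) =o[Filter.atTop] fun X : ℝ => X) := by
  refine ⟨fun D hD => CubicCount.finite_projRedClasses hD, fun O _ _ hD => CubicCount.hRed_eq hD,
    fun X => ⟨CubicCount.finite_quadRingClass (CubicCount.finite_posRange X),
      CubicCount.finite_quadRingClass (CubicCount.finite_negRange X)⟩,
    fun X => CubicCount.sumHRed_eq_sumH fun h => lt_irrefl _ h.1, ?_,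
    fun X => CubicCount.sumHRed_eq_sumH fun h => absurd h.1 (by simp), ?_⟩
  · simp only [CubicCount.posRange_eq]
    exact CubicCount.sumH_isLittleO (by norm_num)
  · simp only [CubicCount.negRange_eq]
    exact CubicCount.sumH_isLittleO (by norm_num)
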